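/- **Setting.** Let $d\ge 1$, let $\mathbb T^{d-1}=(\mathbb R/\mathbb Z)^{d-1}$, and for $N\ge 1$ let $D_N^d=\{1,\dots,N-1\}\times(\mathbb Z/N\mathbb Z)^{d-1}$, whose points are written $x=(x_1,\tilde x)$. Let $\mathcal V\subset\mathbb R^d$ be a finite set of velocities, invariant under sign changes of single coordinates and under permutations of the coordinates. For each $v\in\mathcal V$ let $p(\cdot,v)$ be an irreducible, finite-range probability on $\mathbb Z^d$ with mean $v$, and let $\alpha_v,\beta_v\in C^2(\mathbb T^{d-1})$ take values in a compact subset of $(0,1)$. Fix $\theta\ge 0$. A configuration $\eta\in X_N=\{0,1\}^{D_N^d\times\mathcal V}$ has a particle of velocity $v$ at $x$ iff $\eta(x,v)=1$. Let $\mathcal L_{N,\theta}=N^2(\mathcal L^{b}_{N,\theta}+\mathcal L^{c}_N+\mathcal L^{ex}_N)$, where, for $f:X_N\to\mathbb R$: * (exclusion) $\mathcal L^{ex}_Nf(\eta)=\sum_{v}\sum_{x,z\in D_N^d}\eta(x,v)(1-\eta(z,v))P_N(z-x,v)[f(\eta^{x,z,v})-f(\eta)]$, where $P_N(y,v)=\frac12\sum_{j=1}^d(\delta_{y,e_j}+\delta_{y,-e_j})+\frac1N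 p(y,v)$, $P_N(z-x,v)$ is the sum of $P_N(y,v)$ over all $y\in\mathbb Z^d$ with $x+y=z$ (last $d-1$ coordinates modulo $N$), and $\eta^{x,z,v}$ is $\eta$ with the values $\eta(x,v)$ and $\eta(z,v)$ exchanged; * (collision) $\mathcal L^{c}_Nf(\eta)=\sum_{y\in D_N^d}\sum_{q}\eta(y,v)\eta(y,w)(1-\eta(y,v'))(1-\eta(y,w'))[f(\eta^{y,q})-f(\eta)]$, the sum running over $q=(v,w,v',w')\in\mathcal V^4$ with $v\ne w$, $v'\ne w'$, $v+w=v'+w'$, where $\eta^{y,q}$ is obtained by exchanging $\eta(y,v)$ with $\eta(y,v')$ and $\eta(y,w)$ with $\eta(y,w')$; * (reservoirs) $\mathcal L^{b}_{N,\theta}f(\eta)=N^{-\theta}\sum_{x:\,x_1=1}\sum_v\big[\alpha_v(\tfrac{\tilde x}N)(1-\eta(x,v))+(1-\alpha_v(\tfrac{\tilde x}N))\eta(x,v)\big][f(\sigma^{x,v}\eta)-f(\eta)]$ plus the same expression with $x_1=N-1$ and $\beta_v$ in place of $x_1=1$ and $\alpha_v$, where $\sigma^{x,v}\eta$ is $\eta$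 with $\eta(x,v)$ replaced by $1-\eta(x,v)$. Let $\mu^N$ be an arbitrary probability measure on $X_N$ for each $N$, let $(\eta_s)_{s\ge0}$ be the càdlàg Markov process with generator $\mathcal L_{N,\theta}$ and initial law $\mu^N$, and write $\mathbb E_{\mu^N}$ for its expectation. For $k\in\{0,\dots,d\}$ put $v_0=1$ and $I_k(\eta_x)=\sum_{v\in\mathcal V}v_k\,\eta(x,v)$. Fix $T$, a continuous $G=(G_0,\dots,G_d):[0,T]\times\mathbb T^{d-1}\to\mathbb R^{d+1}$ and $\varepsilon>0$, and set $$V^{1,\ell}_k(\eta,s)=\frac1{N^{d-1}}\sum_{\tilde x}G_k(s,\tfrac{\tilde x}N)\Big(I_k(\eta_{(1,\tilde x)})-\sum_{v}v_k\alpha_v(\tfrac{\tilde x}N)\Big),$$ $$V^{1,r}_k(\eta,s)=\frac1{N^{d-1}}\sum_{\tilde x}G_k(s,\tfrac{\tilde x}N)\Big(I_k(\eta_{(N-1,\tilde x)})-\sum_{v}v_k\beta_v(\tfrac{\tilde x}N)\Big),$$ $$V^{2,\ell}_{k,\varepsilon}(\eta,s)=\frac1{N^{d-1}}\sum_{\tilde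 x}G_k(s,\tfrac{\tilde x}N)\Big(I_k(\eta_{(1,\tilde x)})-\frac1{\lfloor\varepsilon N\rfloor}\sum_{x_1=1}^{\lfloor\varepsilon N\rfloor+1}I_k(\eta_{(x_1,\tilde x)})\Big),$$ $$V^{2,r}_{k,\varepsilon}(\eta,s)=\frac1{N^{d-1}}\sum_{\tilde x}G_k(s,\tfrac{\tilde x}N)\Big(I_k(\eta_{(N-1,\tilde x)})-\frac1{\lfloor\varepsilon N\rfloor}\sum_{x_1=N-1-\lfloor\varepsilon N\rfloor}^{N-1}I_k(\eta_{(x_1,\tilde x)})\Big),$$ where $\tilde x$ runs over $(\mathbb Z/N\mathbb Z)^{d-1}$ and the inner sums are restricted to $1\le x_1\le N-1$. **Proposition (Replacement lemma at the boundary).** Let $0\le t\le T$, $k\in\{0,\dots,d\}$ and $\vartheta\in\{\ell,r\}$. 1. If $0\le\theta<1$, then $\displaystyle\limsup_{N\to\infty}\mathbb E_{\mu^N}\Big[\Big|\int_0^tV^{1,\vartheta}_k(\eta_s,s)\,ds\Big|\Big]=0.$ 2. For every $\theta\ge0$, $\displaystyle\limsup_{\varepsilon\downarrow0}\,\limsup_{N\to\infty}\mathbb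 E_{\mu^N}\Big[\Big|\int_0^tV^{2,\vartheta}_{k,\varepsilon}(\eta_s,s)\,ds\Big|\Big]=0.$ -/

import Mathlib

open Filter Topology MeasureTheory
open scoped NNReal ENNReal

noncomputable section

namespace LatticeGas

/-! Space dimension `d = n + 1`; a point is written `x = (x₁, x̃)`, with `x₁` the coordinate of
index `0` and `x̃` the remaining `n = d - 1` coordinates. -/

/-- The torus `𝕋^{d-1}`. -/
abbrev Torus (n : ℕ) : Type := Fin n → UnitAddCircle

/-- The data of the model in dimension `d = n + 1`. -/
structure Model (n : ℕ) where
  /-- the finite set `𝒱 ⊂ ℝ^d` of velocities -/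
  vel : Finset (Fin (n + 1) → ℝ)
  vel_reflection : ∀ v ∈ vel, ∀ i, Function.update v i (-(v i)) ∈ vel
  vel_permutation : ∀ v ∈ vel, ∀ σ : Equiv.Perm (Fin (n + 1)), v ∘ σ ∈ vel
  /-- the transition probabilities `p(·, v)` on `ℤ^d`; finite range is finite support -/
  p : vel → (Fin (n + 1) → ℤ) →₀ ℝ
  p_nonneg : ∀ v y, 0 ≤ p v y
  p_sum : ∀ v, ((p v).sum fun _ a => a) = 1
  p_mean : ∀ (v : vel) (i : Fin (n + 1)), ((p v).sum fun y a => (y i : ℝ) * a) = v.1 i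
  /-- irreducibility: the walk with steps `p(·, v)` started at `0` reaches every point of `ℤ^d` -/
  p_irreducible : ∀ v, AddSubmonoid.closure {y | p v y ≠ 0} = ⊤
  /-- the reservoir densities at the left boundary -/
  α : vel → Torus n → ℝ
  /-- the reservoir densities at the right boundary -/
  β : vel → Torus n → ℝ
  α_smooth : ∀ v, ContDiff ℝ 2 fun u : Fin n → ℝ => α v fun i => (u i : UnitAddCircle)
  β_smooth : ∀ v, ContDiff ℝ 2 fun u : Fin n → ℝ => β v fun i => (u i : UnitAddCircle)
  α_range : ∀ v, ∃ K : Set ℝ, IsCompact K ∧ K ⊆ Set.Ioo 0 1 ∧ ∀ u, α v u ∈ K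
  β_range : ∀ v, ∃ K : Set ℝ, IsCompact K ∧ K ⊆ Set.Ioo 0 1 ∧ ∀ u, β v u ∈ K

/-- The bulk `D_N^d = {1, …, N-1} × 𝕋_N^{d-1}`, where `𝕋_N = {0, …, N-1}` with addition
modulo `N`. -/
abbrev Site (n N : ℕ) : Type := ↥(Finset.Ico 1 N) × (Fin n → Fin N)

/-- The point `x̃ / N` of `𝕋^{d-1}`. -/
def scaled {n N : ℕ} (x : Site n N) : Torus n :=
  fun i => (((x.2 i : ℕ) : ℝ) / (N : ℝ) : ℝ)

namespace Model

variable {n : ℕ} (M : Model n)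

/-- Configurations: `η x v` says whether a particle of velocity `v` is present at `x`. -/
abbrev Config (N : ℕ) : Type := Site n N → M.vel → Bool

variable {M} {N : ℕ}

/-- The occupation number `η(x, v) ∈ {0, 1}`, as a real number. -/
def occ (η : M.Config N) (x : Site n N) (v : M.vel) : ℝ := if η x v then 1 else 0

/-- The component `v_k`, `k = 0, …, d`, with the convention `v_0 = 1`. -/
def comp (v : M.vel) (k : Fin (n + 2)) : ℝ := (Fin.cons 1 v.1 : Fin (n + 2) → ℝ) k

/-- `I_k(η_x) = ∑_v v_k η(x, v)`: the mass (`k = 0`) or the `k`-th momentum at the site `x`. -/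
def I (k : Fin (n + 2)) (η : M.Config N) (x : Site n N) : ℝ := ∑ v, comp v k * occ η x v

open Classical in
/-- `η^{x,z,v}`: the occupations of velocity `v` at `x` and `z` are exchanged. -/
def exchange (η : M.Config N) (x z : Site n N) (v : M.vel) : M.Config N := fun y w =>
  if w = v ∧ y = x then η z v else if w = v ∧ y = z then η x v else η y w

open Classical in
/-- `σ^{x,v} η`: the occupation of velocity `v` at `x` is flipped. -/
def flip (η : M.Config N) (x : Site n N) (v : M.vel) : M.Config N := fun y w =>
  if w = v ∧ y = x then !(η x v) else η y w

open Classical in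
/-- `η^{y,q}`, the configuration after the collision `q = (v₀, v₁, v₂, v₃)` at the site `y`:
the occupation of `v_j` becomes that of `v_{j+2}`, indices modulo `4`. -/
def collide (η : M.Config N) (y : Site n N) (q : M.vel × M.vel × M.vel × M.vel) :
    M.Config N := fun z u =>
  if z = y then
    if u = q.1 then η y q.2.2.1
    else if u = q.2.1 then η y q.2.2.2
    else if u = q.2.2.1 then η y q.1
    else if u = q.2.2.2 then η y q.2.1
    else η z u
  else η z u

variable (M)

open Classical in
/-- The collisions `q = (v, w, v', w')`: two particles of different velocities `v ≠ w` are turned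
into two particles of different velocities `v' ≠ w'`, with `v + w = v' + w'`. -/
def collisions : Finset (M.vel × M.vel × M.vel × M.vel) :=
  Finset.univ.filter fun q =>
    q.1 ≠ q.2.1 ∧ q.2.2.1 ≠ q.2.2.2 ∧ q.1.1 + q.2.1.1 = q.2.2.1.1 + q.2.2.2.1

/-- `P_N(y, v) = ½ ∑_j (δ_{y,e_j} + δ_{y,-e_j}) + p(y, v) / N`. -/
def P (N : ℕ) (v : M.vel) : (Fin (n + 1) → ℤ) →₀ ℝ :=
  (1 / 2 : ℝ) • ∑ j : Fin (n + 1),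
      (Finsupp.single (Pi.single j (1 : ℤ)) (1 : ℝ) + Finsupp.single (Pi.single j (-1 : ℤ)) (1 : ℝ))
    + (1 / (N : ℝ)) • M.p v

open Classical in
/-- `P_N(z - x, v)` for sites `x, z` of the bulk: the total rate of the displacements `y ∈ ℤ^d`
that lead from `x` to `z`, the last `d - 1` coordinates being taken modulo `N`. -/
def jumpRate (x z : Site n N) (v : M.vel) : ℝ :=
  (M.P N v).sum fun y a =>
    if ((z.1 : ℕ) : ℤ) - ((x.1 : ℕ) : ℤ) = y 0 ∧
        ∀ i : Fin n, ((z.2 i : ℕ) : ℤ) - ((x.2 i : ℕ) : ℤ) ≡ y i.succ [ZMOD (N : ℤ)]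
    then a else 0

/-- The exclusion part of the generator. -/
def genEx (f : M.Config N → ℝ) (η : M.Config N) : ℝ :=
  ∑ v : M.vel, ∑ x : Site n N, ∑ z : Site n N,
    occ η x v * (1 - occ η z v) * M.jumpRate x z v * (f (exchange η x z v) - f η)

/-- The collision part of the generator. -/
def genColl (f : M.Config N → ℝ) (η : M.Config N) : ℝ :=
  ∑ y : Site n N, ∑ q ∈ M.collisions,
    occ η y q.1 * occ η y q.2.1 * (1 - occ η y q.2.2.1) * (1 - occ η y q.2.2.2)
      * (f (collide η y q) - f η)

/-- The sites of the left boundary, `x₁ = 1`. -/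
def leftSites (n N : ℕ) : Finset (Site n N) := Finset.univ.filter fun x => (x.1 : ℕ) = 1

/-- The sites of the right boundary, `x₁ = N - 1`. -/
def rightSites (n N : ℕ) : Finset (Site n N) := Finset.univ.filter fun x => (x.1 : ℕ) + 1 = N

/-- The Glauber part of the generator, with parameter `θ`. -/
def genGlauber (θ : ℝ) (f : M.Config N → ℝ) (η : M.Config N) : ℝ :=
  (1 / (N : ℝ) ^ θ) * ∑ x ∈ leftSites n N, ∑ v : M.vel,
      (M.α v (scaled x) * (1 - occ η x v) + (1 - M.α v (scaled x)) * occ η x v)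
        * (f (flip η x v) - f η)
  + (1 / (N : ℝ) ^ θ) * ∑ x ∈ rightSites n N, ∑ v : M.vel,
      (M.β v (scaled x) * (1 - occ η x v) + (1 - M.β v (scaled x)) * occ η x v)
        * (f (flip η x v) - f η)

/-- The generator `𝓛_{N,θ} = N² (𝓛^b_{N,θ} + 𝓛^c_N + 𝓛^ex_N)`. -/
def gen (θ : ℝ) (f : M.Config N → ℝ) (η : M.Config N) : ℝ :=
  (N : ℝ) ^ 2 * (M.genGlauber θ f η + M.genColl f η + M.genEx f η)

open Classical in
/-- The transition probabilities `S_t(η, ξ)`: the entries of `exp (t 𝓛_{N,θ})`, where `𝓛_{N,θ}` is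
read as the matrix with entries `(𝓛_{N,θ} 𝟙_ξ)(η)`. -/
def transition (N : ℕ) (θ : ℝ) (t : ℝ) (η ξ : M.Config N) : ℝ :=
  NormedSpace.exp
    (t • (Matrix.of fun η' ξ' => M.gen θ (Pi.single ξ' 1) η' :
      Matrix (M.Config N) (M.Config N) ℝ)) η ξ

/-- `η` is, on the probability space `(Ω, ℙ)`, a càdlàg Markov process with generator `𝓛_{N,θ}`
and initial distribution `μ`. -/
structure IsMarkovDynamics (N : ℕ) (θ : ℝ) (μ : Measure (M.Config N)) {Ω : Type*} [MeasurableSpace Ω]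
    (ℙ : Measure Ω) (η : ℝ≥0 → Ω → M.Config N) : Prop where
  measurable : ∀ t, Measurable (η t)
  right_continuous : ∀ ω t, ContinuousWithinAt (fun s => η s ω) (Set.Ici t) t
  left_limits : ∀ ω t, ∃ ξ, Tendsto (fun s => η s ω) (𝓝[<] t) (𝓝 ξ)
  initial : ℙ.map (η 0) = μ
  /-- the Markov property, with transition probabilities `S_{t-s}`: given the state at time `s`
  and the states at finitely many earlier times `τ i` -/
  markov : ∀ (m : ℕ) (τ : Fin m → ℝ≥0) (ζ : Fin m → M.Config N) (s t : ℝ≥0)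
    (ξ ξ' : M.Config N), (∀ i, τ i ≤ s) → s ≤ t →
    ℙ.real {ω | (∀ i, η (τ i) ω = ζ i) ∧ η s ω = ξ ∧ η t ω = ξ'} =
      ℙ.real {ω | (∀ i, η (τ i) ω = ζ i) ∧ η s ω = ξ} *
        M.transition N θ ((t : ℝ) - (s : ℝ)) ξ ξ'

/-! The boundary fluctuations, for a test function `g` on `𝕋^{d-1}` (the component `G_k(s, ·)`). -/

/-- `V_k^{1,ℓ}`: left boundary occupation minus left reservoir density. -/
def V1left (k : Fin (n + 2)) (g : Torus n → ℝ) (η : M.Config N) : ℝ :=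
  (1 / (N : ℝ) ^ n) * ∑ x ∈ leftSites n N,
    g (scaled x) * (I k η x - ∑ v : M.vel, comp v k * M.α v (scaled x))

/-- `V_k^{1,r}`: right boundary occupation minus right reservoir density. -/
def V1right (k : Fin (n + 2)) (g : Torus n → ℝ) (η : M.Config N) : ℝ :=
  (1 / (N : ℝ) ^ n) * ∑ x ∈ rightSites n N,
    g (scaled x) * (I k η x - ∑ v : M.vel, comp v k * M.β v (scaled x))

/-- `V_k^{2,ℓ}`: left boundary occupation minus its average over
`1 ≤ x₁ ≤ ⌊εN⌋ + 1`. -/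
def V2left (ε : ℝ) (k : Fin (n + 2)) (g : Torus n → ℝ) (η : M.Config N) : ℝ :=
  (1 / (N : ℝ) ^ n) * ∑ x ∈ leftSites n N,
    g (scaled x) * (I k η x - (1 / (⌊ε * N⌋₊ : ℝ)) *
      ∑ y ∈ (Finset.univ : Finset ↥(Finset.Ico 1 N)).filter (fun y : ↥(Finset.Ico 1 N) => (y.1 : ℕ) ≤ ⌊ε * N⌋₊ + 1),
        I k η (y, x.2))

/-- `V_k^{2,r}`: right boundary occupation minus its average over
`N - 1 - ⌊εN⌋ ≤ x₁ ≤ N - 1`. -/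
def V2right (ε : ℝ) (k : Fin (n + 2)) (g : Torus n → ℝ) (η : M.Config N) : ℝ :=
  (1 / (N : ℝ) ^ n) * ∑ x ∈ rightSites n N,
    g (scaled x) * (I k η x - (1 / (⌊ε * N⌋₊ : ℝ)) *
      ∑ y ∈ (Finset.univ : Finset ↥(Finset.Ico 1 N)).filter (fun y : ↥(Finset.Ico 1 N) => N ≤ (y.1 : ℕ) + 1 + ⌊ε * N⌋₊),
        I k η (y, x.2))

end Model

end LatticeGas

end

/-!
The four time integrals vanish because each boundary fluctuation `V` is, up to a small error, in
the range of the generator: there is a small function `F` on configurations such that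
`𝓛 F + V` is small, uniformly over configurations. Neither entropy nor Dirichlet forms are needed,
which is why the initial distribution is arbitrary.

*From the Poisson equation to the time integral.* The second moment of `∫ V(η_s) ds` is twice the
integral of `𝔼[V(η_s) V(η_r)]` over `s ≤ r`. For fixed `s`, Dynkin's formula applied to `F` from
time `s` on, correlated with `V(η_s)`, bounds the integral over `r` by the suprema of `F` and
`𝓛 F + V` (`IsMarkovDynamics.integral_sq_le`).

*Solving the Poisson equation.* Take `F(η) = N^{-(d-1)} ∑_x g(x̃/N) h(x₁) I_k(η_x)` with `g` smooth.
Collisions conserve `I_k`. The symmetric exclusion acts on functions that are linear in the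
occupation numbers as the discrete Laplacian, reflected at the ends of `{1, …, N-1}`. The
reservoirs give `-N^{2-θ} (h(1) V¹ˡ + h(N-1) V¹ʳ)`. The tangential Laplacian of `g` and the weakly
asymmetric jumps cost at most a constant times `∑ |h| + N ∑ |∇h|` (`gen_testObs_sub_le`).

* For `V¹` the profile `h` is affine, equal to `N^{θ-2}` at one end and to `0` at the other; all
  errors are of order `N^{θ-1}`, which tends to `0` because `θ < 1`.
* For `V²` the profile is `-2 N^{-2}` times an average, over the window of width `⌊εN⌋`, of Green
  functions of the Dirichlet problem on `{1, …, N-1}`. It vanishes at both ends, so the reservoirs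
  play no role and `θ ≥ 0` is arbitrary; its reflected Laplacian is the difference between the
  boundary occupation and the average over the window, up to `O(ε)` (`exists_poisson_average`).

*Continuous test functions.* `G` is approximated uniformly by functions that are piecewise constant
in time and trigonometric polynomials in space (`exists_threshold`).
-/

noncomputable section

namespace LatticeGas

/-! ### Second moments of time integrals -/

/-- The second moment of `∫ₐᵇ x_s ds` is twice the integral of the correlations `𝔼[x_s x_r]` over
the triangle `s ≤ r`, so it suffices to control, for each `s`, the correlations with the future. -/
theorem integral_sq_intervalIntegral_le {Ω : Type*} [MeasurableSpace Ω] (ℙ : Measure Ω)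
    [IsProbabilityMeasure ℙ] (x : ℝ → Ω → ℝ) (hx : Measurable (Function.uncurry x)) {C : ℝ}
    (hC : ∀ s ω, |x s ω| ≤ C) {a b c : ℝ} (hab : a ≤ b)
    (h : ∀ s ∈ Set.Ioc a b, |∫ r in s..b, ∫ ω, x s ω * x r ω ∂ℙ| ≤ c) :
    ∫ ω, (∫ s in a..b, x s ω) ^ 2 ∂ℙ ≤ 2 * ((b - a) * c) := by
  set ν : Measure ℝ := volume.restrict (Set.Ioc a b) with hν
  have hνf : IsFiniteMeasure ν := by rw [hν]; infer_instance
  have hxx : Measurable fun q : Ω × (ℝ × ℝ) => x q.2.1 q.1 * x q.2.2 q.1 :=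
    (hx.comp (f := fun q : Ω × (ℝ × ℝ) => (q.2.1, q.1)) (by fun_prop)).mul
      (hx.comp (f := fun q : Ω × (ℝ × ℝ) => (q.2.2, q.1)) (by fun_prop))
  have hbd : ∀ s r ω, ‖x s ω * x r ω‖ ≤ C * C := fun s r ω => by
    rw [Real.norm_eq_abs, abs_mul]
    exact mul_le_mul (hC _ _) (hC _ _) (abs_nonneg _) ((abs_nonneg _).trans (hC s ω))
  set κ : ℝ × ℝ → ℝ := fun p => ∫ ω, x p.1 ω * x p.2 ω ∂ℙ with hκ
  have hκm : StronglyMeasurable κ := by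
    have : StronglyMeasurable (Function.uncurry fun (p : ℝ × ℝ) (ω : Ω) => x p.1 ω * x p.2 ω) :=
      (hxx.comp measurable_swap).stronglyMeasurable
    exact this.integral_prod_right
  have hκb : ∀ p, ‖κ p‖ ≤ C * C := fun p => by
    have := norm_integral_le_of_norm_le_const (μ := ℙ)
      (Filter.Eventually.of_forall fun ω => hbd p.1 p.2 ω)
    simpa using this
  have hκi : ∀ A : Set (ℝ × ℝ), MeasurableSet A → Integrable (A.indicator κ) (ν.prod ν) :=
    fun A hA => (Integrable.of_bound hκm.aestronglyMeasurable (C * C)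
      (Filter.Eventually.of_forall hκb)).indicator hA
  -- the square is cut along the diagonal; the two triangles contribute equally by symmetry
  have hsymm : ∀ s r, κ (s, r) = κ (r, s) := fun s r => by
    simp only [hκ]; exact integral_congr_ae (Filter.Eventually.of_forall fun ω => mul_comm _ _)
  have h1 : ∫ ω, (∫ s in a..b, x s ω) ^ 2 ∂ℙ = ∫ p, κ p ∂(ν.prod ν) := by
    have : ∀ ω, (∫ s in a..b, x s ω) ^ 2 = ∫ p, x p.1 ω * x p.2 ω ∂(ν.prod ν) := fun ω => by
      rw [intervalIntegral.integral_of_le hab, sq, ← integral_prod_mul]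
    simp_rw [this]
    rw [integral_integral_swap]
    exact Integrable.of_bound hxx.aestronglyMeasurable (C * C)
      (Filter.Eventually.of_forall fun q => hbd _ _ _)
  set A : Set (ℝ × ℝ) := {p | p.1 < p.2} with hA
  have hAm : MeasurableSet A := measurableSet_lt measurable_fst measurable_snd
  have hA'm : MeasurableSet {p : ℝ × ℝ | p.1 ≤ p.2} := measurableSet_le measurable_fst measurable_snd
  have hAc : Aᶜ = {p : ℝ × ℝ | p.2 ≤ p.1} := by ext p; simp [hA]
  have h2 : ∫ p, κ p ∂(ν.prod ν) =
      ∫ p, A.indicator κ p ∂(ν.prod ν) + ∫ p, Aᶜ.indicator κ p ∂(ν.prod ν) := by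
    rw [← integral_add (hκi _ hAm) (hκi _ hAm.compl)]
    simp
  have h3 : ∫ p, Aᶜ.indicator κ p ∂(ν.prod ν) =
      ∫ p, ({p : ℝ × ℝ | p.1 ≤ p.2}).indicator κ p ∂(ν.prod ν) := by
    rw [← integral_prod_swap]
    refine integral_congr_ae (Filter.Eventually.of_forall fun p => ?_)
    simp only [hAc, Set.indicator, Set.mem_ofPred_eq, Prod.fst_swap, Prod.snd_swap]
    split_ifs with h'
    · exact hsymm _ _
    · rfl
  have hIoc : ∀ s ∈ Set.Ioc a b, ∫ r, A.indicator κ (s, r) ∂ν = ∫ r in s..b, κ (s, r) := by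
    intro s hs
    have : (fun r => A.indicator κ (s, r)) = (Set.Ioi s).indicator fun r => κ (s, r) := by
      ext r; simp [Set.indicator, hA]
    rw [this, integral_indicator measurableSet_Ioi, hν, Measure.restrict_restrict measurableSet_Ioi,
      intervalIntegral.integral_of_le hs.2]
    congr 2
    ext r; simp only [Set.mem_inter_iff, Set.mem_Ioi, Set.mem_Ioc]
    exact ⟨fun h => ⟨h.1, h.2.2⟩, fun h => ⟨h.1, hs.1.trans h.1, h.2⟩⟩
  have hIcc : ∀ s ∈ Set.Ioc a b,
      ∫ r, ({p : ℝ × ℝ | p.1 ≤ p.2}).indicator κ (s, r) ∂ν = ∫ r in s..b, κ (s, r) := by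
    intro s hs
    have : (fun r => ({p : ℝ × ℝ | p.1 ≤ p.2}).indicator κ (s, r)) =
        (Set.Ici s).indicator fun r => κ (s, r) := by
      ext r; simp [Set.indicator]
    rw [this, integral_indicator measurableSet_Ici, hν, Measure.restrict_restrict measurableSet_Ici,
      intervalIntegral.integral_of_le hs.2, ← integral_Icc_eq_integral_Ioc]
    congr 2
    ext r; simp only [Set.mem_inter_iff, Set.mem_Ici, Set.mem_Ioc, Set.mem_Icc]
    exact ⟨fun h => ⟨h.1, h.2.2⟩, fun h => ⟨h.1, hs.1.trans_le h.1, h.2⟩⟩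
  have key : ∀ B : Set (ℝ × ℝ), MeasurableSet B →
      (∀ s ∈ Set.Ioc a b, ∫ r, B.indicator κ (s, r) ∂ν = ∫ r in s..b, κ (s, r)) →
      ∫ p, B.indicator κ p ∂(ν.prod ν) ≤ (b - a) * c := by
    intro B hB hBi
    rw [integral_prod _ (hκi B hB)]
    have h4 : ‖∫ s in Set.Ioc a b, ∫ r, B.indicator κ (s, r) ∂ν‖ ≤ c * volume.real (Set.Ioc a b) :=
      norm_setIntegral_le_of_norm_le_const measure_Ioc_lt_top fun s hs => by
        rw [hBi s hs]; exact h s hs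
    rw [Real.volume_real_Ioc_of_le hab, mul_comm] at h4
    exact (le_abs_self _).trans h4
  rw [h1, h2, h3]
  linarith [key A hAm hIoc, key _ hA'm hIcc]

/-- A function of a right-continuous process with values in a discrete space is jointly measurable
in time and randomness: it is the limit of its values at the grid times
`(⌊s (m + 1)⌋ + 1) / (m + 1)`, which tend to `s` from the right. -/
theorem measurable_uncurry_of_rightContinuous {Ω S : Type*} [MeasurableSpace Ω] [MeasurableSpace S]
    [DiscreteMeasurableSpace S] [TopologicalSpace S] [DiscreteTopology S] {η : ℝ≥0 → Ω → S}
    (hm : ∀ t, Measurable (η t))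
    (hr : ∀ ω t, ContinuousWithinAt (fun s => η s ω) (Set.Ici t) t) (f : S → ℝ) :
    Measurable fun p : ℝ≥0 × Ω => f (η p.1 p.2) := by
  let τ : ℕ → ℝ≥0 → ℝ≥0 := fun m s => ((⌊s * (m + 1)⌋₊ : ℝ≥0) + 1) / (m + 1)
  have hτ : ∀ s, Tendsto (fun m => τ m s) atTop (𝓝[≥] s) := by
    intro s
    refine tendsto_nhdsWithin_iff.2 ⟨?_, Filter.Eventually.of_forall fun m => ?_⟩
    · refine tendsto_of_tendsto_of_tendsto_of_le_of_le (g := fun _ => s)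
        (h := fun m : ℕ => s + 1 / ((m : ℝ≥0) + 1)) tendsto_const_nhds ?_ ?_ ?_
      · have : Tendsto (fun m : ℕ => 1 / ((m : ℝ≥0) + 1)) atTop (𝓝 0) := by
          exact_mod_cast tendsto_one_div_add_atTop_nhds_zero_nat (𝕜 := ℝ≥0)
        simpa using this.const_add s
      · intro m
        change s ≤ _ / _
        rw [le_div_iff₀ (by positivity)]
        exact (Nat.lt_floor_add_one _).le
      · intro m
        change _ / _ ≤ _
        rw [div_le_iff₀ (by positivity), add_mul, one_div, inv_mul_cancel₀ (by positivity)]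
        gcongr
        exact Nat.floor_le (by positivity)
    · change s ≤ _ / _
      rw [le_div_iff₀ (by positivity)]
      exact (Nat.lt_floor_add_one _).le
  refine measurable_of_tendsto_metrizable (f := fun m (p : ℝ≥0 × Ω) => f (η (τ m p.1) p.2))
    (fun m => ?_) ?_
  · have h1 : Measurable fun q : ℕ × Ω => f (η (((q.1 : ℝ≥0) + 1) / (m + 1)) q.2) :=
      measurable_from_prod_countable_right fun k =>
        (Measurable.of_discrete (f := f)).comp (hm (((k : ℝ≥0) + 1) / (m + 1)))
    have h2 : Measurable fun p : ℝ≥0 × Ω => (⌊p.1 * ((m : ℝ≥0) + 1)⌋₊, p.2) :=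
      (Nat.measurable_floor.comp (measurable_fst.mul_const _)).prodMk measurable_snd
    have h3 := h1.comp h2
    simp only [Function.comp_def] at h3
    exact h3
  · refine tendsto_pi_nhds.2 fun p => ?_
    have h1 : Tendsto (fun m => η (τ m p.1) p.2) atTop (𝓝 (η p.1 p.2)) :=
      (hr p.2 p.1).tendsto.comp (hτ p.1)
    exact ((continuous_of_discreteTopology (f := f)).tendsto _).comp h1

/-! ### Dynkin's formula -/

section Matrix
open scoped Matrix Matrix.Norms.Operator

/-- Kolmogorov's backward equation, tested against `w` and `F`. -/
theorem hasDerivAt_dotProduct_exp {S : Type*} [Fintype S] [DecidableEq S] (Q : Matrix S S ℝ)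
    (w F : S → ℝ) (u : ℝ) :
    HasDerivAt (fun u : ℝ => w ⬝ᵥ (NormedSpace.exp (u • Q) *ᵥ F))
      (w ⬝ᵥ (NormedSpace.exp (u • Q) *ᵥ (Q *ᵥ F))) u := by
  have h := hasDerivAt_exp_smul_const (𝕂 := ℝ) Q u
  let ℓ : Matrix S S ℝ →ₗ[ℝ] ℝ :=
    { toFun := fun A => w ⬝ᵥ (A *ᵥ F)
      map_add' := fun A B => by rw [Matrix.add_mulVec, dotProduct_add]
      map_smul' := fun c A => by rw [Matrix.smul_mulVec, dotProduct_smul]; rfl }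
  have h2 := (LinearMap.toContinuousLinearMap ℓ).hasFDerivAt.comp_hasDerivAt u h
  rw [Matrix.mulVec_mulVec]
  exact h2

end Matrix

namespace Model
variable {n : ℕ} (M : Model n) {N : ℕ}

/-- The generator as a linear map. -/
def genLin (N : ℕ) (θ : ℝ) : (M.Config N → ℝ) →ₗ[ℝ] (M.Config N → ℝ) where
  toFun f := M.gen θ f
  map_add' f g := by
    funext η
    simp only [gen, genGlauber, genColl, genEx, Pi.add_apply, mul_add, add_sub_add_comm,
      Finset.sum_add_distrib]
    ring
  map_smul' c f := by
    funext η
    have h : ∀ a x y : ℝ, a * (c * x - c * y) = c * (a * (x - y)) := fun a x y => by ring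
    simp only [gen, genGlauber, genColl, genEx, Pi.smul_apply, smul_eq_mul, h, ← Finset.mul_sum,
      RingHom.id_apply]
    ring

open Classical in
/-- The generator as a matrix. -/
def genMatrix (N : ℕ) (θ : ℝ) : Matrix (M.Config N) (M.Config N) ℝ :=
  Matrix.of fun η' ξ' => M.gen θ (Pi.single ξ' 1) η'

/-- The generator is linear, hence determined by its values on indicator functions. -/
theorem genMatrix_mulVec (θ : ℝ) (F : M.Config N → ℝ) : (M.genMatrix N θ).mulVec F = M.gen θ F := by
  classical
  have h : M.gen θ F = ∑ ξ, F ξ • M.gen θ (Pi.single ξ 1) := by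
    have h1 := congrArg (M.genLin N θ) (pi_eq_sum_univ' F)
    rw [map_sum] at h1
    simp_rw [map_smul] at h1
    exact h1
  funext η
  rw [h, Finset.sum_apply]
  simp only [Matrix.mulVec, dotProduct, genMatrix, Matrix.of_apply, Pi.smul_apply, smul_eq_mul]
  exact Finset.sum_congr rfl fun ξ _ => by rw [mul_comm]

variable {M}
variable {θ : ℝ} {μ : Measure (M.Config N)} {Ω : Type*} [MeasurableSpace Ω] {ℙ : Measure Ω}
  {η : ℝ≥0 → Ω → M.Config N}

/-- The Markov property for two times, as a formula for two-time correlations. -/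
theorem IsMarkovDynamics.integral_mul [IsProbabilityMeasure ℙ] (hη : M.IsMarkovDynamics N θ μ ℙ η)
    (f F : M.Config N → ℝ) {s r : ℝ≥0} (hsr : s ≤ r) :
    ∫ ω, f (η s ω) * F (η r ω) ∂ℙ =
      (fun ξ => f ξ * ℙ.real {ω | η s ω = ξ}) ⬝ᵥ
        (NormedSpace.exp (((r : ℝ) - (s : ℝ)) • M.genMatrix N θ)).mulVec F := by
  have hY : Measurable fun ω => (η s ω, η r ω) := (hη.measurable s).prodMk (hη.measurable r)
  have h1 : ∫ ω, f (η s ω) * F (η r ω) ∂ℙ =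
      ∫ p, f p.1 * F p.2 ∂(ℙ.map fun ω => (η s ω, η r ω)) := by
    rw [integral_map hY.aemeasurable]
    exact Measurable.of_discrete.aestronglyMeasurable
  have : IsProbabilityMeasure (ℙ.map fun ω => (η s ω, η r ω)) :=
    Measure.isProbabilityMeasure_map hY.aemeasurable
  rw [h1, integral_fintype (Integrable.of_finite), Fintype.sum_prod_type, dotProduct]
  refine Finset.sum_congr rfl fun ξ _ => ?_
  rw [Matrix.mulVec, dotProduct, Finset.mul_sum]
  refine Finset.sum_congr rfl fun ξ' _ => ?_
  have h2 := hη.markov 0 (fun i => i.elim0) (fun i => i.elim0) s r ξ ξ' (fun i => i.elim0) hsr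
  simp only [IsEmpty.forall_iff, true_and] at h2
  rw [map_measureReal_apply hY (by measurability)]
  have h3 : (fun ω => (η s ω, η r ω)) ⁻¹' {(ξ, ξ')} = {ω | η s ω = ξ ∧ η r ω = ξ'} := by
    ext ω; simp
  rw [h3, h2, smul_eq_mul]
  change _ * M.transition N θ _ _ _ * _ = _ * (M.transition N θ _ _ _ * _)
  ring

/-- Dynkin's formula, correlated with the state at the initial time. -/
theorem IsMarkovDynamics.dynkin [IsProbabilityMeasure ℙ] (hη : M.IsMarkovDynamics N θ μ ℙ η)
    (f F : M.Config N → ℝ) {s b : ℝ} (hs : 0 ≤ s) (hsb : s ≤ b) :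
    ∫ r in s..b, ∫ ω, f (η s.toNNReal ω) * M.gen θ F (η r.toNNReal ω) ∂ℙ =
      ∫ ω, f (η s.toNNReal ω) * F (η b.toNNReal ω) ∂ℙ -
        ∫ ω, f (η s.toNNReal ω) * F (η s.toNNReal ω) ∂ℙ := by
  classical
  set w : M.Config N → ℝ := fun ξ => f ξ * ℙ.real {ω | η s.toNNReal ω = ξ}
  set Q := M.genMatrix N θ
  have key : ∀ (F' : M.Config N → ℝ) (r : ℝ), s ≤ r →
      ∫ ω, f (η s.toNNReal ω) * F' (η r.toNNReal ω) ∂ℙ =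
        w ⬝ᵥ (NormedSpace.exp ((r - s) • Q)).mulVec F' := by
    intro F' r hr
    rw [hη.integral_mul f F' (Real.toNNReal_le_toNNReal hr), Real.coe_toNNReal _ (hs.trans hr),
      Real.coe_toNNReal _ hs]
  have hd : ∀ (F' : M.Config N → ℝ) (r : ℝ), HasDerivAt
      (fun r : ℝ => w ⬝ᵥ (NormedSpace.exp ((r - s) • Q)).mulVec F')
      (w ⬝ᵥ (NormedSpace.exp ((r - s) • Q)).mulVec (Q.mulVec F')) r := by
    intro F' r
    have := (hasDerivAt_dotProduct_exp Q w F' (r - s)).comp r ((hasDerivAt_id r).sub_const s)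
    rw [mul_one] at this
    exact this
  rw [key _ b hsb, key _ s le_rfl, ← genMatrix_mulVec]
  rw [← intervalIntegral.integral_eq_sub_of_hasDerivAt (fun r _ => hd F r)
    (Continuous.intervalIntegrable
      (continuous_iff_continuousAt.2 fun r => (hd (Q.mulVec F) r).continuousAt) _ _)]
  refine intervalIntegral.integral_congr fun r hr => ?_
  rw [Set.uIcc_of_le hsb] at hr
  exact key _ r hr.1

theorem IsMarkovDynamics.measurable_uncurry (hη : M.IsMarkovDynamics N θ μ ℙ η)
    (f : M.Config N → ℝ) : Measurable (Function.uncurry fun (s : ℝ) ω => f (η s.toNNReal ω)) :=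
  (measurable_uncurry_of_rightContinuous hη.measurable hη.right_continuous f).comp
    (f := fun p : ℝ × Ω => (p.1.toNNReal, p.2)) (by fun_prop)

theorem IsMarkovDynamics.stronglyMeasurable_integral (hη : M.IsMarkovDynamics N θ μ ℙ η)
    (V : M.Config N → ℝ) {a b : ℝ} (hab : a ≤ b) :
    StronglyMeasurable fun ω => ∫ s in a..b, V (η s.toNNReal ω) := by
  have h : StronglyMeasurable (Function.uncurry fun (ω : Ω) (s : ℝ) => V (η s.toNNReal ω)) :=
    ((hη.measurable_uncurry V).comp measurable_swap).stronglyMeasurable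
  simp only [intervalIntegral.integral_of_le hab]
  exact h.integral_prod_right

/-- If `F` approximately solves the Poisson equation `𝓛 F = -V`, the time integral of `V` along the
dynamics is small in mean square, whatever the initial distribution. -/
theorem IsMarkovDynamics.integral_sq_le [IsProbabilityMeasure ℙ] (hη : M.IsMarkovDynamics N θ μ ℙ η)
    {V F : M.Config N → ℝ} {C δ : ℝ} (hV : ∀ ξ, |V ξ| ≤ C) (hF : ∀ ξ, |F ξ| ≤ δ)
    (hgen : ∀ ξ, |M.gen θ F ξ + V ξ| ≤ δ) {a b : ℝ} (ha : 0 ≤ a) (hab : a ≤ b) :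
    ∫ ω, (∫ s in a..b, V (η s.toNNReal ω)) ^ 2 ∂ℙ ≤ 2 * ((b - a) * (C * δ * (2 + (b - a)))) := by
  have hmeas : ∀ (f : M.Config N → ℝ) (s : ℝ), Measurable fun ω => f (η s.toNNReal ω) := fun f s =>
    (Measurable.of_discrete (f := f)).comp (hη.measurable _)
  have hint : ∀ (f g : M.Config N → ℝ) (s r : ℝ),
      Integrable (fun ω => f (η s.toNNReal ω) * g (η r.toNNReal ω)) ℙ := by
    intro f g s r
    obtain ⟨K, hK⟩ := (Set.finite_range fun p : M.Config N × M.Config N => ‖f p.1 * g p.2‖).bddAbove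
    exact Integrable.of_bound ((hmeas f s).mul (hmeas g r)).aestronglyMeasurable K
      (Filter.Eventually.of_forall fun ω => hK ⟨(_, _), rfl⟩)
  have hbound : ∀ (f g : M.Config N → ℝ) (A B : ℝ), (∀ ξ, |f ξ| ≤ A) → (∀ ξ, |g ξ| ≤ B) →
      ∀ s r : ℝ, |∫ ω, f (η s.toNNReal ω) * g (η r.toNNReal ω) ∂ℙ| ≤ A * B := by
    intro f g A B hf hg s r
    have := norm_integral_le_of_norm_le_const (μ := ℙ) (C := A * B)
      (f := fun ω => f (η s.toNNReal ω) * g (η r.toNNReal ω))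
      (Filter.Eventually.of_forall fun ω => by
        rw [Real.norm_eq_abs, abs_mul]
        exact mul_le_mul (hf _) (hg _) (abs_nonneg _) ((abs_nonneg _).trans (hf (η 0 ω))))
    simpa using this
  refine integral_sq_intervalIntegral_le ℙ (fun s ω => V (η s.toNNReal ω))
    (hη.measurable_uncurry V) (fun _ _ => hV _) hab fun s hs => ?_
  have hsplit : ∀ r : ℝ, ∫ ω, V (η s.toNNReal ω) * V (η r.toNNReal ω) ∂ℙ =
      ∫ ω, V (η s.toNNReal ω) * (M.gen θ F (η r.toNNReal ω) + V (η r.toNNReal ω)) ∂ℙ -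
        ∫ ω, V (η s.toNNReal ω) * M.gen θ F (η r.toNNReal ω) ∂ℙ := by
    intro r
    rw [← integral_sub (hint V (fun ξ => M.gen θ F ξ + V ξ) s r) (hint _ _ s r)]
    exact integral_congr_ae (Filter.Eventually.of_forall fun ω => by ring)
  have hii : ∀ g : M.Config N → ℝ, IntervalIntegrable
      (fun r : ℝ => ∫ ω, V (η s.toNNReal ω) * g (η r.toNNReal ω) ∂ℙ) volume s b := by
    intro g
    obtain ⟨K, hK⟩ := (Set.finite_range fun ξ => |g ξ|).bddAbove
    have hm : StronglyMeasurable (Function.uncurry fun (r : ℝ) (ω : Ω) =>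
        V (η s.toNNReal ω) * g (η r.toNNReal ω)) :=
      (((hmeas V s).comp measurable_snd).mul (hη.measurable_uncurry g)).stronglyMeasurable
    rw [intervalIntegrable_iff_integrableOn_Ioc_of_le hs.2]
    exact Integrable.of_bound hm.integral_prod_right.aestronglyMeasurable (C * K)
      (Filter.Eventually.of_forall fun r => hbound V g C K hV (fun ξ => hK ⟨ξ, rfl⟩) s r)
  simp_rw [hsplit]
  rw [intervalIntegral.integral_sub (hii fun ξ => M.gen θ F ξ + V ξ) (hii (M.gen θ F)),
    hη.dynkin V F (ha.trans hs.1.le) hs.2]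
  have h1 : ‖∫ r in s..b, ∫ ω, V (η s.toNNReal ω) *
      (M.gen θ F (η r.toNNReal ω) + V (η r.toNNReal ω)) ∂ℙ‖ ≤ C * δ * |b - s| :=
    intervalIntegral.norm_integral_le_of_norm_le_const fun r _ =>
      hbound V (fun ξ => M.gen θ F ξ + V ξ) C δ hV hgen s r
  rw [Real.norm_eq_abs, abs_of_nonneg (sub_nonneg.2 hs.2)] at h1
  have h2 := hbound V F C δ hV hF s b
  have h3 := hbound V F C δ hV hF s s
  have ξ0 : M.Config N := fun _ _ => false
  have hC : 0 ≤ C * δ := mul_nonneg ((abs_nonneg _).trans (hV ξ0)) ((abs_nonneg _).trans (hF ξ0))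
  have h4 : C * δ * (b - s) ≤ C * δ * (b - a) := by
    apply mul_le_mul_of_nonneg_left _ hC; linarith [hs.1]
  rw [abs_le] at *
  constructor <;> linarith [h1.1, h1.2, h2.1, h2.2, h3.1, h3.2]

/-- The same bound in mean. -/
theorem IsMarkovDynamics.lintegral_enorm_le [IsProbabilityMeasure ℙ]
    (hη : M.IsMarkovDynamics N θ μ ℙ η)
    {V F : M.Config N → ℝ} {C δ c : ℝ} (hV : ∀ ξ, |V ξ| ≤ C) (hF : ∀ ξ, |F ξ| ≤ δ)
    (hgen : ∀ ξ, |M.gen θ F ξ + V ξ| ≤ δ) {a b : ℝ} (ha : 0 ≤ a) (hab : a ≤ b) (hc : 0 < c)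
    (h : 2 * ((b - a) * (C * δ * (2 + (b - a)))) ≤ c ^ 2) :
    ∫⁻ ω, ‖∫ s in a..b, V (η s.toNNReal ω)‖ₑ ∂ℙ ≤ ENNReal.ofReal c := by
  set Z : Ω → ℝ := fun ω => ∫ s in a..b, V (η s.toNNReal ω) with hZ
  have hZm : StronglyMeasurable Z := hη.stronglyMeasurable_integral V hab
  have hZb : ∀ ω, |Z ω| ≤ C * |b - a| := fun ω => by
    rw [← Real.norm_eq_abs (Z ω)]
    exact intervalIntegral.norm_integral_le_of_norm_le_const fun _ _ => hV _
  have hZi : Integrable Z ℙ := Integrable.of_bound hZm.aestronglyMeasurable (C * |b - a|)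
    (Filter.Eventually.of_forall hZb)
  have hZ2 : Integrable (fun ω => Z ω ^ 2) ℙ :=
    Integrable.of_bound (hZm.pow 2).aestronglyMeasurable ((C * |b - a|) ^ 2)
      (Filter.Eventually.of_forall fun ω => by
        rw [Real.norm_eq_abs, abs_pow]; exact pow_le_pow_left₀ (abs_nonneg _) (hZb ω) 2)
  -- Young's inequality replaces Cauchy-Schwarz
  have h1 : ∫ ω, |Z ω| ∂ℙ ≤ ∫ ω, (c / 2 + Z ω ^ 2 / (2 * c)) ∂ℙ := by
    refine integral_mono hZi.abs ((integrable_const _).add (hZ2.div_const _)) fun ω => ?_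
    have : 0 ≤ (c - |Z ω|) ^ 2 / (2 * c) := by positivity
    have e : (c - |Z ω|) ^ 2 / (2 * c) = c / 2 + Z ω ^ 2 / (2 * c) - |Z ω| := by
      rw [← sq_abs (Z ω)]; field_simp; ring
    dsimp only
    linarith
  rw [integral_add (integrable_const _) (hZ2.div_const _), integral_div (2 * c) fun ω => Z ω ^ 2] at h1
  have h2 : (∫ ω, Z ω ^ 2 ∂ℙ) / (2 * c) ≤ c / 2 := by
    rw [div_le_iff₀ (by positivity)]
    have := (hη.integral_sq_le hV hF hgen ha hab).trans h
    linarith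
  have h3 : ∫ ω, |Z ω| ∂ℙ ≤ c := by simp at h1; linarith
  have h4 := ofReal_integral_norm_eq_lintegral_enorm hZi
  rw [← h4]
  exact ENNReal.ofReal_le_ofReal h3

end Model

/-! ### Smooth functions on the torus -/

/-- The class in the torus of a vector of `ℝ^{d-1}`. -/
def Torus.mk {n : ℕ} (a : Fin n → ℝ) : Torus n := fun i => (a i : UnitAddCircle)

/-- Quantitative `C²` regularity, expressed with finite differences: `g` and its first and second
order difference quotients are bounded by `K`. -/
structure SmoothBound {n : ℕ} {E : Type*} [NormedAddCommGroup E] (K : ℝ) (g : Torus n → E) :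
    Prop where
  bound : ∀ u, ‖g u‖ ≤ K
  lip : ∀ u (a : Fin n → ℝ), ‖g (u + Torus.mk a) - g u‖ ≤ K * ∑ i, |a i|
  second : ∀ u i (s : ℝ), ‖(g (u + Torus.mk (Pi.single i s)) - g u) +
    (g (u + Torus.mk (Pi.single i (-s))) - g u)‖ ≤ K * s ^ 2

namespace SmoothBound

variable {n : ℕ} {E : Type*} [NormedAddCommGroup E]

theorem zero : SmoothBound 0 (0 : Torus n → E) := by
  constructor <;> intros <;> simp

theorem mono {K L : ℝ} {g : Torus n → E} (hg : SmoothBound K g) (h : K ≤ L) : SmoothBound L g where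
  bound u := (hg.bound u).trans h
  lip u a := (hg.lip u a).trans
    (mul_le_mul_of_nonneg_right h (Finset.sum_nonneg fun _ _ => abs_nonneg _))
  second u i s := (hg.second u i s).trans (mul_le_mul_of_nonneg_right h (sq_nonneg s))

theorem add {K L : ℝ} {f g : Torus n → E} (hf : SmoothBound K f) (hg : SmoothBound L g) :
    SmoothBound (K + L) (f + g) := by
  constructor
  · intro u
    exact (norm_add_le _ _).trans (add_le_add (hf.bound u) (hg.bound u))
  · intro u a
    simp only [Pi.add_apply, add_sub_add_comm, add_mul]
    exact (norm_add_le _ _).trans (add_le_add (hf.lip u a) (hg.lip u a))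
  · intro u i s
    simp only [Pi.add_apply, add_sub_add_comm, add_mul]
    rw [add_add_add_comm]
    exact (norm_add_le _ _).trans (add_le_add (hf.second u i s) (hg.second u i s))

theorem clm_comp {F : Type*} [NormedAddCommGroup F] [NormedSpace ℝ E] [NormedSpace ℝ F] {K C : ℝ}
    {f : Torus n → E} (hf : SmoothBound K f) (ℓ : E →L[ℝ] F) (hC : 0 ≤ C) (hℓ : ∀ x, ‖ℓ x‖ ≤ C * ‖x‖) :
    SmoothBound (C * K) fun u => ℓ (f u) := by
  constructor
  · intro u
    exact (hℓ _).trans (mul_le_mul_of_nonneg_left (hf.bound u) hC)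
  · intro u a
    rw [← map_sub, mul_assoc]
    exact (hℓ _).trans (mul_le_mul_of_nonneg_left (hf.lip u a) hC)
  · intro u i s
    rw [← map_sub, ← map_sub, ← map_add, mul_assoc]
    exact (hℓ _).trans (mul_le_mul_of_nonneg_left (hf.second u i s) hC)

end SmoothBound

open UnitAddTorus

theorem mFourier_add_apply {n : ℕ} (k : Fin n → ℤ) (u w : Torus n) :
    mFourier k (u + w) = mFourier k u * mFourier k w := by
  simp [mFourier, fourier_apply, smul_add, AddCircle.toCircle_add, Finset.prod_mul_distrib]

theorem mFourier_mk {n : ℕ} (k : Fin n → ℤ) (a : Fin n → ℝ) :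
    mFourier k (Torus.mk a) = Complex.exp (Complex.I * ((2 * Real.pi * ∑ i, k i * a i : ℝ) : ℂ)) := by
  simp only [mFourier, ContinuousMap.coe_mk, Torus.mk, fourier_coe_apply, ← Complex.exp_sum]
  congr 1
  push_cast
  rw [Finset.mul_sum, Finset.mul_sum]
  exact Finset.sum_congr rfl fun i _ => by simp; ring

theorem smoothBound_mFourier {n : ℕ} (k : Fin n → ℤ) :
    ∃ K, SmoothBound K fun u : Torus n => mFourier k u := by
  set κ : ℝ := 2 * Real.pi * ∑ i, |(k i : ℝ)| with hκ
  have hκ0 : 0 ≤ κ := by positivity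
  have h1 : ∀ u : Torus n, ‖mFourier k u‖ = 1 := fun u => by
    simp only [mFourier, ContinuousMap.coe_mk, fourier_apply, norm_prod]
    exact Finset.prod_eq_one fun b _ => Circle.norm_coe _
  have h2 : ∀ a : Fin n → ℝ, |2 * Real.pi * ∑ i, k i * a i| ≤ κ * ∑ i, |a i| := by
    intro a
    rw [abs_mul, abs_of_pos Real.two_pi_pos, hκ, mul_assoc (2 * Real.pi)]
    refine mul_le_mul_of_nonneg_left ?_ Real.two_pi_pos.le
    refine (Finset.abs_sum_le_sum_abs _ _).trans ?_
    rw [Finset.mul_sum]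
    refine Finset.sum_le_sum fun i _ => ?_
    rw [abs_mul]
    exact mul_le_mul_of_nonneg_right
      (Finset.single_le_sum (f := fun i => |(k i : ℝ)|) (fun _ _ => abs_nonneg _)
        (Finset.mem_univ i)) (abs_nonneg _)
  refine ⟨1 + κ + κ ^ 2, ?_, ?_, ?_⟩
  · intro u
    rw [h1]; nlinarith
  · intro u a
    rw [mFourier_add_apply, ← mul_sub_one, norm_mul, h1, one_mul, mFourier_mk]
    refine (Real.norm_exp_I_mul_ofReal_sub_one_le).trans ((h2 a).trans ?_)
    refine mul_le_mul_of_nonneg_right ?_ (Finset.sum_nonneg fun _ _ => abs_nonneg _)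
    nlinarith
  · intro u i s
    have h3 : ∀ s : ℝ, ∑ j, (k j : ℝ) * (Pi.single i s : Fin n → ℝ) j = k i * s := fun s => by
      simp [Pi.single_apply]
    have h4 := h2 (Pi.single i s)
    have h5 : ∑ j, |(Pi.single i s : Fin n → ℝ) j| = |s| := by
      rw [Finset.sum_eq_single i] <;> simp +contextual
    rw [h3, h5] at h4
    rw [mFourier_add_apply, mFourier_add_apply, ← mul_sub_one, ← mul_sub_one, ← mul_add, norm_mul,
      h1, one_mul, mFourier_mk, mFourier_mk, h3, h3]
    set y : ℝ := 2 * Real.pi * (k i * s)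
    have h6 : (2 * Real.pi * (k i * -s) : ℝ) = -y := by simp only [y]; ring
    rw [h6]
    have h7 : Complex.exp (Complex.I * (y : ℂ)) - 1 + (Complex.exp (Complex.I * ((-y : ℝ) : ℂ)) - 1) =
        ((2 * (Real.cos y - 1) : ℝ) : ℂ) := by
      rw [mul_comm, mul_comm Complex.I]
      push_cast
      rw [Complex.exp_mul_I, Complex.exp_mul_I, Complex.cos_neg, Complex.sin_neg]
      ring
    rw [h7, Complex.norm_real, Real.norm_eq_abs, abs_le]
    have h8 := Real.one_sub_sq_div_two_le_cos (x := y)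
    have h9 := Real.cos_le_one y
    have h10 : y ^ 2 ≤ κ ^ 2 * s ^ 2 := by
      rw [← sq_abs y, ← sq_abs s, ← mul_pow]
      exact pow_le_pow_left₀ (abs_nonneg _) h4 2
    have h11 : κ ^ 2 * s ^ 2 ≤ (1 + κ + κ ^ 2) * s ^ 2 :=
      mul_le_mul_of_nonneg_right (by linarith) (sq_nonneg _)
    constructor
    · linarith
    · nlinarith [sq_nonneg y]

/-- Trigonometric polynomials are smooth and uniformly dense. -/
theorem exists_smoothBound_approx {n : ℕ} {g : Torus n → ℝ} (hg : Continuous g) {ε : ℝ}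
    (hε : 0 < ε) : ∃ (K : ℝ) (f : Torus n → ℝ), SmoothBound K f ∧ ∀ u, |g u - f u| ≤ ε := by
  have hspan : ∀ p ∈ Submodule.span ℂ (Set.range (mFourier (d := Fin n))),
      ∃ K, SmoothBound K fun u : Torus n => p u := by
    intro p hp
    induction hp using Submodule.span_induction with
    | mem p hp => obtain ⟨k, rfl⟩ := hp; exact smoothBound_mFourier k
    | zero => exact ⟨0, SmoothBound.zero⟩
    | add p q _ _ hp hq =>
      obtain ⟨K, hK⟩ := hp
      obtain ⟨L, hL⟩ := hq
      exact ⟨K + L, hK.add hL⟩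
    | smul c p _ hp =>
      obtain ⟨K, hK⟩ := hp
      exact ⟨‖c‖ * K, hK.clm_comp ((ContinuousLinearMap.mul ℝ ℂ) c) (norm_nonneg c)
        fun x => by simp⟩
  let gc : C(UnitAddTorus (Fin n), ℂ) := ⟨fun u => (g u : ℂ), by fun_prop⟩
  have hgc : gc ∈ (Submodule.span ℂ (Set.range (mFourier (d := Fin n)))).topologicalClosure := by
    rw [span_mFourier_closure_eq_top]; trivial
  obtain ⟨p, hp, hpg⟩ := Metric.mem_closure_iff.1 hgc ε hε
  obtain ⟨K, hK⟩ := hspan p hp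
  refine ⟨1 * K, _, hK.clm_comp Complex.reCLM zero_le_one fun x => by
    simpa using Complex.abs_re_le_norm x, fun u => ?_⟩
  have h1 : ‖gc u - p u‖ ≤ ε := by
    rw [← dist_eq_norm]
    exact (ContinuousMap.dist_apply_le_dist u).trans hpg.le
  have h2 := (Complex.abs_re_le_norm (gc u - p u)).trans h1
  simpa [gc] using h2

namespace Model
variable {n : ℕ} {M : Model n} {N : ℕ}

/-! ### The generator on functions that are linear in the occupation numbers -/

/-- The function `η ↦ ∑_{x,v} w(x, v) η(x, v)`. -/
def linearObs (w : Site n N → M.vel → ℝ) (η : M.Config N) : ℝ := ∑ x, ∑ v, w x v * occ η x v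

theorem occ_eq_zero_or_one (η : M.Config N) (x : Site n N) (v : M.vel) :
    occ η x v = 0 ∨ occ η x v = 1 := by
  unfold occ; split_ifs <;> simp

theorem occ_nonneg (η : M.Config N) (x : Site n N) (v : M.vel) : 0 ≤ occ η x v := by
  rcases occ_eq_zero_or_one η x v with h | h <;> simp [h]

theorem occ_le_one (η : M.Config N) (x : Site n N) (v : M.vel) : occ η x v ≤ 1 := by
  rcases occ_eq_zero_or_one η x v with h | h <;> simp [h]

theorem linearObs_sub (w : Site n N → M.vel → ℝ) (η ξ : M.Config N) :
    linearObs w ξ - linearObs w η = ∑ x, ∑ v, w x v * (occ ξ x v - occ η x v) := by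
  simp only [linearObs, mul_sub, Finset.sum_sub_distrib]

theorem sum_sum_mul_ite [DecidableEq (Site n N)] [DecidableEq M.vel] (w : Site n N → M.vel → ℝ)
    (x : Site n N) (v : M.vel) (a : ℝ) :
    ∑ y, ∑ u, w y u * (if u = v ∧ y = x then a else 0) = w x v * a := by
  simp [ite_and]

theorem linearObs_flip (w : Site n N → M.vel → ℝ) (η : M.Config N) (x : Site n N) (v : M.vel) :
    linearObs w (flip η x v) - linearObs w η = w x v * (1 - 2 * occ η x v) := by
  classical
  rw [linearObs_sub, ← sum_sum_mul_ite]
  refine Finset.sum_congr rfl fun y _ => Finset.sum_congr rfl fun u _ => ?_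
  congr 1
  simp only [occ, flip]
  by_cases h : u = v ∧ y = x
  · obtain ⟨rfl, rfl⟩ := h
    by_cases h' : η y u = true <;> simp only [h', and_self, if_true] <;> norm_num
  · simp [h]

/-- The formula also covers `x = z`, where both sides vanish. -/
theorem linearObs_exchange (w : Site n N → M.vel → ℝ) (η : M.Config N) (x z : Site n N)
    (v : M.vel) : linearObs w (exchange η x z v) - linearObs w η =
      (w z v - w x v) * (occ η x v - occ η z v) := by
  classical
  have : (w z v - w x v) * (occ η x v - occ η z v) =
      w x v * (occ η z v - occ η x v) + w z v * (occ η x v - occ η z v) := by ring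
  rw [linearObs_sub, this, ← sum_sum_mul_ite, ← sum_sum_mul_ite, ← Finset.sum_add_distrib]
  refine Finset.sum_congr rfl fun y _ => ?_
  rw [← Finset.sum_add_distrib]
  refine Finset.sum_congr rfl fun u _ => ?_
  rw [← mul_add]
  congr 1
  simp only [occ, exchange]
  by_cases h : u = v ∧ y = x
  · obtain ⟨rfl, rfl⟩ := h
    by_cases h2 : y = z
    · subst h2; simp
    · simp [h2]
  · by_cases h2 : u = v ∧ y = z
    · obtain ⟨rfl, rfl⟩ := h2
      have hx : y ≠ x := fun e => h ⟨rfl, e⟩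
      simp [hx]
    · simp [h, h2]

/-- Mass and momentum are conserved by collisions. -/
theorem comp_add_comp_of_mem_collisions {q : M.vel × M.vel × M.vel × M.vel}
    (hq : q ∈ M.collisions) (k : Fin (n + 2)) :
    comp q.2.2.1 k + comp q.2.2.2 k = comp q.1 k + comp q.2.1 k := by
  classical
  have h := ((Finset.mem_filter.1 hq).2).2.2
  refine Fin.cases ?_ (fun i => ?_) k
  · simp [comp]
  · have := congrFun h i
    simp only [Pi.add_apply] at this
    simp only [comp, Fin.cons_succ]
    exact this.symm

/-- A collision that occurs with positive rate moves particles from two occupied velocities to two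
empty ones, so the four velocities are distinct and the change of `I_k` is read off from the
conservation laws. -/
theorem genColl_linearObs (H : Site n N → ℝ) (k : Fin (n + 2)) (η : M.Config N) :
    M.genColl (linearObs fun x v => H x * comp v k) η = 0 := by
  classical
  refine Finset.sum_eq_zero fun y _ => Finset.sum_eq_zero fun q hq => ?_
  obtain ⟨v, w, v', w'⟩ := q
  have hne := (Finset.mem_filter.1 hq).2
  have hc := comp_add_comp_of_mem_collisions hq k
  simp only at hne hc ⊢
  rcases occ_eq_zero_or_one η y v with h1 | h1
  · simp [h1]
  rcases occ_eq_zero_or_one η y w with h2 | h2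
  · simp [h2]
  rcases occ_eq_zero_or_one η y v' with h3 | h3
  swap
  · simp [h3]
  rcases occ_eq_zero_or_one η y w' with h4 | h4
  swap
  · simp [h4]
  suffices hs : linearObs (fun x v => H x * comp v k) (collide η y (v, w, v', w')) -
      linearObs (fun x v => H x * comp v k) η =
      H y * comp v' k * 1 + H y * comp w' k * 1 + H y * comp v k * (-1) + H y * comp w k * (-1) by
    rw [hs]
    have : H y * comp v' k * 1 + H y * comp w' k * 1 + H y * comp v k * (-1) +
      H y * comp w k * (-1) = H y * (comp v' k + comp w' k - (comp v k + comp w k)) := by ring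
    rw [this, hc]; ring
  rw [linearObs_sub]
  have e : ∀ (u : M.vel) (a : ℝ), H y * comp u k * a =
      ∑ x, ∑ u', H x * comp u' k * (if u' = u ∧ x = y then a else 0) := fun u a =>
    (sum_sum_mul_ite (fun x v => H x * comp v k) y u a).symm
  rw [e, e, e, e, ← Finset.sum_add_distrib, ← Finset.sum_add_distrib, ← Finset.sum_add_distrib]
  refine Finset.sum_congr rfl fun x _ => ?_
  rw [← Finset.sum_add_distrib, ← Finset.sum_add_distrib, ← Finset.sum_add_distrib]
  refine Finset.sum_congr rfl fun u _ => ?_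
  rw [← mul_add, ← mul_add, ← mul_add]
  congr 1
  by_cases hx : x = y
  · subst hx
    have hoc : occ (collide η x (v, w, v', w')) x u = if u = v then occ η x v' else
        if u = w then occ η x w' else if u = v' then occ η x v else
        if u = w' then occ η x w else occ η x u := by
      simp only [occ, collide]; split_ifs <;> simp_all
    rw [hoc, h1, h2, h3, h4]
    have n1 : v ≠ v' := fun h => by rw [h, h3] at h1; norm_num at h1
    have n2 : v ≠ w' := fun h => by rw [h, h4] at h1; norm_num at h1
    have n3 : w ≠ v' := fun h => by rw [h, h3] at h2; norm_num at h2
    have n4 : w ≠ w' := fun h => by rw [h, h4] at h2; norm_num at h2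
    by_cases a1 : u = v
    · subst a1; simp [h1, hne.1, n1, n2]
    by_cases a2 : u = w
    · subst a2; simp [h2, hne.1.symm, n3, n4]
    by_cases a3 : u = v'
    · subst a3; simp [h3, hne.2.1, n1.symm, n3.symm]
    by_cases a4 : u = w'
    · subst a4; simp [h4, hne.2.1.symm, n2.symm, n4.symm]
    simp [a1, a2, a3, a4]
  · simp [occ, collide, hx]

theorem genEx_linearObs (w : Site n N → M.vel → ℝ) (η : M.Config N) :
    M.genEx (linearObs w) η = ∑ v, ∑ x, ∑ z,
      occ η x v * (1 - occ η z v) * M.jumpRate x z v * (w z v - w x v) := by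
  refine Finset.sum_congr rfl fun v _ => Finset.sum_congr rfl fun x _ =>
    Finset.sum_congr rfl fun z _ => ?_
  rw [linearObs_exchange]
  rcases occ_eq_zero_or_one η x v with h1 | h1 <;> rcases occ_eq_zero_or_one η z v with h2 | h2 <;>
    simp [h1, h2]

/-- A reservoir of density `ρ` at `x` pulls `I_k(η_x)` towards its mean. -/
theorem glauber_linearObs_sum (H : Site n N → ℝ) (k : Fin (n + 2)) (η : M.Config N) (x : Site n N)
    (ρ : M.vel → ℝ) :
    ∑ v, (ρ v * (1 - occ η x v) + (1 - ρ v) * occ η x v) *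
      (linearObs (fun x v => H x * comp v k) (flip η x v) -
        linearObs (fun x v => H x * comp v k) η) =
      -(H x * (I k η x - ∑ v, comp v k * ρ v)) := by
  rw [I, ← Finset.sum_sub_distrib, Finset.mul_sum, ← Finset.sum_neg_distrib]
  refine Finset.sum_congr rfl fun v _ => ?_
  rw [linearObs_flip]
  rcases occ_eq_zero_or_one η x v with h1 | h1 <;> rw [h1] <;> ring

/-- The test function `N^{-(d-1)} ∑_x g(x̃/N) h(x₁) I_k(η_x)`. -/
def testObs (k : Fin (n + 2)) (g : Torus n → ℝ) (h : ℕ → ℝ) : M.Config N → ℝ :=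
  linearObs fun x v => 1 / (N : ℝ) ^ n * (g (scaled x) * h x.1) * comp v k

theorem genGlauber_testObs (θ : ℝ) (k : Fin (n + 2)) (g : Torus n → ℝ) (h : ℕ → ℝ)
    (η : M.Config N) :
    M.genGlauber θ (testObs k g h) η =
      -(1 / (N : ℝ) ^ θ * (h 1 * M.V1left k g η + h (N - 1) * M.V1right k g η)) := by
  have h1 : ∀ (x : Site n N) (ρ : M.vel → ℝ), ∑ v, (ρ v * (1 - occ η x v) + (1 - ρ v) * occ η x v) *
      (testObs k g h (flip η x v) - testObs k g h η) =
      -(1 / (N : ℝ) ^ n * (g (scaled x) * h x.1) * (I k η x - ∑ v, comp v k * ρ v)) :=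
    fun x ρ => glauber_linearObs_sum _ k η x ρ
  rw [genGlauber]
  simp_rw [h1]
  rw [V1left, V1right, mul_add, neg_add]
  congr 1
  · rw [← mul_neg]
    congr 1
    rw [← mul_assoc, Finset.mul_sum, ← Finset.sum_neg_distrib]
    refine Finset.sum_congr rfl fun x hx => ?_
    rw [(Finset.mem_filter.1 hx).2]
    ring
  · rw [← mul_neg]
    congr 1
    rw [← mul_assoc, Finset.mul_sum, ← Finset.sum_neg_distrib]
    refine Finset.sum_congr rfl fun x hx => ?_
    have : (x.1 : ℕ) = N - 1 := by have := (Finset.mem_filter.1 hx).2; omega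
    rw [this]
    ring

end Model

/-! ### Displacements on the discrete torus -/

section Displacement
variable {n N : ℕ}

/-- The translation of `x̃ ∈ 𝕋_N^{d-1}` by a vector of `ℤ^{d-1}`. -/
def translate (x : Fin n → Fin N) (a : Fin n → ℤ) : Fin n → Fin N := fun i =>
  ⟨(((x i : ℕ) + a i : ℤ) % (N : ℤ)).toNat, by
    have hN : (0 : ℤ) < N := by exact_mod_cast (x i).pos
    have h1 := Int.emod_nonneg ((x i : ℕ) + a i : ℤ) hN.ne'
    have h2 := Int.emod_lt_of_pos ((x i : ℕ) + a i : ℤ) hN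
    omega⟩

/-- The congruences in the definition of the jump rates determine the target in `𝕋_N^{d-1}`. -/
theorem eq_translate_iff (x z : Fin n → Fin N) (a : Fin n → ℤ) :
    (∀ i, ((z i : ℕ) : ℤ) - ((x i : ℕ) : ℤ) ≡ a i [ZMOD (N : ℤ)]) ↔ z = translate x a := by
  rw [funext_iff]
  refine forall_congr' fun i => ?_
  have hN : (0 : ℤ) < N := by exact_mod_cast (x i).pos
  have h1 := Int.emod_nonneg ((x i : ℕ) + a i : ℤ) hN.ne'
  have hz : ((z i : ℕ) : ℤ) % N = (z i : ℕ) :=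
    Int.emod_eq_of_lt (by positivity) (by exact_mod_cast (z i).isLt)
  have h3 : (((z i : ℕ) : ℤ) - ((x i : ℕ) : ℤ) ≡ a i [ZMOD (N : ℤ)]) ↔
      ((z i : ℕ) : ℤ) ≡ (x i : ℕ) + a i [ZMOD (N : ℤ)] := by
    constructor
    · intro h
      have := h.add_left ((x i : ℕ) : ℤ)
      simpa using this
    · intro h
      have := h.sub_right ((x i : ℕ) : ℤ)
      simpa using this
  rw [h3, Int.ModEq, hz, Fin.ext_iff]
  simp only [translate]
  omega

/-- The point `x̃ / N` of the torus. -/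
def scaledT (x : Fin n → Fin N) : Torus n := fun i => (((x i : ℕ) : ℝ) / (N : ℝ) : ℝ)

theorem scaledT_translate (x : Fin n → Fin N) (a : Fin n → ℤ) :
    scaledT (translate x a) = scaledT x + Torus.mk fun i => (a i : ℝ) / N := by
  funext i
  have hN : (0 : ℤ) < N := by exact_mod_cast (x i).pos
  have hN' : (N : ℝ) ≠ 0 := by exact_mod_cast hN.ne'
  have h1 := Int.emod_nonneg ((x i : ℕ) + a i : ℤ) hN.ne'
  have h2 : ((translate x a i : ℕ) : ℤ) = ((x i : ℕ) + a i : ℤ) % N := Int.toNat_of_nonneg h1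
  have h3 := Int.emod_add_mul_ediv ((x i : ℕ) + a i : ℤ) N
  rw [← h2] at h3
  have h4 : ((translate x a i : ℕ) : ℝ) + N * ((((x i : ℕ) + a i : ℤ) / N : ℤ) : ℝ) =
      (x i : ℕ) + a i := by exact_mod_cast h3
  simp only [scaledT, Torus.mk, Pi.add_apply]
  rw [← AddCircle.coe_add, ← add_div, ← h4, add_div, mul_div_cancel_left₀ _ hN', AddCircle.coe_add]
  have : ((((((x i : ℕ) + a i : ℤ) / N : ℤ) : ℝ) : ℝ) : UnitAddCircle) = 0 := by
    rw [AddCircle.coe_eq_zero_iff]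
    exact ⟨((x i : ℕ) + a i : ℤ) / N, by simp⟩
  rw [this, add_zero]

/-- The displacement `y` leads from `x` to `z`. -/
def Leads (x z : Site n N) (y : Fin (n + 1) → ℤ) : Prop :=
  ((z.1 : ℕ) : ℤ) - ((x.1 : ℕ) : ℤ) = y 0 ∧
    ∀ i : Fin n, ((z.2 i : ℕ) : ℤ) - ((x.2 i : ℕ) : ℤ) ≡ y i.succ [ZMOD (N : ℤ)]

theorem leads_neg (x z : Site n N) (y : Fin (n + 1) → ℤ) : Leads z x (-y) ↔ Leads x z y := by
  simp only [Leads, Pi.neg_apply]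
  refine and_congr (by omega) (forall_congr' fun i => ?_)
  constructor <;> intro h <;> simpa using h.neg

theorem leads_iff (x z : Site n N) (y : Fin (n + 1) → ℤ) :
    Leads x z y ↔ ((z.1 : ℕ) : ℤ) - ((x.1 : ℕ) : ℤ) = y 0 ∧ z.2 = translate x.2 fun i => y i.succ :=
  and_congr Iff.rfl (eq_translate_iff _ _ _)

open Classical in
/-- Given `z₁`, exactly one `z` over it is reached from `x` by the displacement `y`. -/
theorem sum_leads (x : Site n N) (y : Fin (n + 1) → ℤ) (Φ : Site n N → ℝ) :
    ∑ z, (if Leads x z y then Φ z else 0) =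
      ∑ z₁ : ↥(Finset.Ico 1 N), if ((z₁ : ℕ) : ℤ) - ((x.1 : ℕ) : ℤ) = y 0 then
        Φ (z₁, translate x.2 fun i => y i.succ) else 0 := by
  rw [Fintype.sum_prod_type]
  refine Finset.sum_congr rfl fun z₁ _ => ?_
  simp only [leads_iff, ite_and]
  split_ifs
  · simp
  · simp

theorem sum_Ico_subtype (f : ℕ → ℝ) : ∑ z : ↥(Finset.Ico 1 N), f z = ∑ z ∈ Finset.Ico 1 N, f z :=
  Finset.sum_coe_sort (Finset.Ico 1 N) f

theorem sum_site_normal (φ : ℕ → ℝ) :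
    ∑ x : Site n N, φ x.1 = (N : ℝ) ^ n * ∑ x ∈ Finset.Ico 1 N, φ x := by
  rw [Fintype.sum_prod_type, ← sum_Ico_subtype, Finset.mul_sum]
  simp

/-- The reflected discrete Laplacian on `{1, …, N-1}`. -/
def lap (N : ℕ) (h : ℕ → ℝ) (x : ℕ) : ℝ :=
  (if x + 1 < N then h (x + 1) - h x else 0) + (if 1 < x then h (x - 1) - h x else 0)

/-- The mesh-`1/N` discrete Laplacian on the torus. -/
def tangLap (N : ℕ) (g : Torus n → ℝ) (u : Torus n) : ℝ :=
  ∑ i, ((g (u + Torus.mk (Pi.single i (1 / (N : ℝ)))) - g u) +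
    (g (u + Torus.mk (Pi.single i (-(1 / (N : ℝ))))) - g u))

theorem abs_tangLap_le {K : ℝ} {g : Torus n → ℝ} (hg : SmoothBound K g) (u : Torus n) :
    |tangLap N g u| ≤ n * (K * (1 / (N : ℝ)) ^ 2) := by
  refine (Finset.abs_sum_le_sum_abs _ _).trans ((Finset.sum_le_sum fun i _ =>
    hg.second u i (1 / (N : ℝ))).trans ?_)
  simp

theorem scaledT_translate_single (x : Fin n → Fin N) (i : Fin n) (a : ℤ) :
    scaledT (translate x (Pi.single i a)) = scaledT x + Torus.mk (Pi.single i (a / (N : ℝ))) := by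
  rw [scaledT_translate]
  congr 2
  funext j
  by_cases h : j = i
  · subst h; simp
  · simp [h]

theorem scaledT_translate_zero (x : Fin n → Fin N) :
    scaledT (translate x 0) = scaledT x := by
  rw [scaledT_translate]
  funext j
  simp [Torus.mk]

open Classical in
theorem sum_leads_single_zero (x : Site n N) (a : ℤ) (g : Torus n → ℝ) (h : ℕ → ℝ) :
    ∑ z, (if Leads x z (Pi.single 0 a) then g (scaled z) * h z.1 - g (scaled x) * h x.1 else 0) =
      g (scaled x) * ∑ z ∈ Finset.Ico 1 N, if (z : ℤ) - ((x.1 : ℕ) : ℤ) = a then h z - h x.1 else 0 := by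
  have e : (fun i : Fin n => (Pi.single 0 a : Fin (n + 1) → ℤ) i.succ) = 0 := by
    funext i; simp
  rw [sum_leads, e, ← sum_Ico_subtype, Finset.mul_sum]
  refine Finset.sum_congr rfl fun z _ => ?_
  have e2 : scaled (z, translate x.2 0) = scaled x := scaledT_translate_zero x.2
  rw [Pi.single_eq_same, e2, mul_ite, mul_zero, mul_sub]

open Classical in
theorem sum_leads_single_succ (x : Site n N) (i : Fin n) (a : ℤ) (g : Torus n → ℝ) (h : ℕ → ℝ) :
    ∑ z, (if Leads x z (Pi.single i.succ a) then
        g (scaled z) * h z.1 - g (scaled x) * h x.1 else 0) =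
      h x.1 * (g (scaled x + Torus.mk (Pi.single i (a / (N : ℝ)))) - g (scaled x)) := by
  have e : (fun j : Fin n => (Pi.single i.succ a : Fin (n + 1) → ℤ) j.succ) = Pi.single i a := by
    funext j
    by_cases hj : j = i
    · subst hj; simp
    · simp [hj]
  rw [sum_leads, e, Finset.sum_eq_single x.1]
  · have e2 : scaled (x.1, translate x.2 (Pi.single i a)) =
      scaled x + Torus.mk (Pi.single i (a / (N : ℝ))) := scaledT_translate_single x.2 i a
    rw [e2]
    simp
    ring
  · intro z _ hz
    rw [if_neg]
    intro h0
    apply hz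
    have : (Pi.single i.succ a : Fin (n + 1) → ℤ) 0 = 0 := by
      simp [Fin.succ_ne_zero, eq_comm]
    rw [this] at h0
    exact Subtype.ext (by omega)
  · simp

theorem sum_Ico_neighbours (h : ℕ → ℝ) {x : ℕ} (hx : x ∈ Finset.Ico 1 N) :
    (∑ z ∈ Finset.Ico 1 N, if (z : ℤ) - (x : ℤ) = 1 then h z - h x else 0) +
      (∑ z ∈ Finset.Ico 1 N, if (z : ℤ) - (x : ℤ) = -1 then h z - h x else 0) = lap N h x := by
  have hx := Finset.mem_Ico.1 hx
  have e1 : ∀ z : ℕ, ((z : ℤ) - (x : ℤ) = 1) = (z = x + 1) := fun z => propext (by omega)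
  have e2 : ∀ z : ℕ, ((z : ℤ) - (x : ℤ) = -1) = (z = x - 1) := fun z => propext (by omega)
  simp only [e1, e2, Finset.sum_ite_eq', Finset.mem_Ico, lap]
  congr 1
  · exact if_congr (by omega) rfl rfl
  · exact if_congr (by omega) rfl rfl

open Classical in
/-- The symmetric nearest-neighbour jumps act on `g ⊗ h` through discrete Laplacians. -/
theorem sum_nearest_neighbour (x : Site n N) (g : Torus n → ℝ) (h : ℕ → ℝ) :
    ∑ j : Fin (n + 1), ∑ z, ((if Leads x z (Pi.single j 1) then
        g (scaled z) * h z.1 - g (scaled x) * h x.1 else 0) +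
      (if Leads x z (Pi.single j (-1)) then g (scaled z) * h z.1 - g (scaled x) * h x.1 else 0)) =
      g (scaled x) * lap N h x.1 + h x.1 * tangLap N g (scaled x) := by
  simp only [Finset.sum_add_distrib (s := (Finset.univ : Finset (Site n N)))]
  rw [Fin.sum_univ_succ, sum_leads_single_zero, sum_leads_single_zero, ← mul_add,
    sum_Ico_neighbours h x.1.2, tangLap, Finset.mul_sum]
  congr 1
  refine Finset.sum_congr rfl fun i _ => ?_
  rw [sum_leads_single_succ, sum_leads_single_succ, ← mul_add]
  simp only [Int.cast_one, Int.cast_neg, neg_div]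

/-- The increments of `h` over a distance `a` are bounded by `|a|` times its total variation. -/
theorem sum_abs_increment_le (h : ℕ → ℝ) (a : ℤ) :
    ∑ x ∈ Finset.Ico 1 N, ∑ z ∈ Finset.Ico 1 N, (if (z : ℤ) - (x : ℤ) = a then |h z - h x| else 0) ≤
      |(a : ℝ)| * ∑ x ∈ Finset.Ico 1 (N - 1), |h (x + 1) - h x| := by
  have hpos : ∀ m : ℕ, ∑ x ∈ Finset.Ico 1 N, ∑ z ∈ Finset.Ico 1 N,
      (if (z : ℤ) - (x : ℤ) = m then |h z - h x| else 0) ≤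
        m * ∑ x ∈ Finset.Ico 1 (N - 1), |h (x + 1) - h x| := by
    intro m
    have e1 : ∀ x z : ℕ, ((z : ℤ) - (x : ℤ) = m) = (z = x + m) := fun x z => propext (by omega)
    simp only [e1, Finset.sum_ite_eq', Finset.mem_Ico]
    calc ∑ x ∈ Finset.Ico 1 N, (if 1 ≤ x + m ∧ x + m < N then |h (x + m) - h x| else 0)
        ≤ ∑ x ∈ Finset.Ico 1 N, ∑ j ∈ Finset.range m,
          (if x + j ∈ Finset.Ico 1 (N - 1) then |h (x + j + 1) - h (x + j)| else 0) := by
          refine Finset.sum_le_sum fun x hx => ?_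
          have hx := Finset.mem_Ico.1 hx
          split_ifs with hc
          · have h2 : ∑ j ∈ Finset.range m,
                (if x + j ∈ Finset.Ico 1 (N - 1) then |h (x + j + 1) - h (x + j)| else 0) =
                ∑ j ∈ Finset.range m, |h (x + (j + 1)) - h (x + j)| := by
              refine Finset.sum_congr rfl fun j hj => ?_
              have := Finset.mem_range.1 hj
              rw [if_pos (Finset.mem_Ico.2 ⟨by omega, by omega⟩), add_assoc]
            rw [h2]
            have h3 := Finset.sum_range_sub (fun j => h (x + j)) m
            simp only [add_zero] at h3
            rw [← h3]
            exact Finset.abs_sum_le_sum_abs _ _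
          · exact Finset.sum_nonneg fun j _ => by split_ifs <;> positivity
      _ = ∑ j ∈ Finset.range m, ∑ x ∈ Finset.Ico 1 N,
          (if x + j ∈ Finset.Ico 1 (N - 1) then |h (x + j + 1) - h (x + j)| else 0) :=
          Finset.sum_comm
      _ ≤ ∑ j ∈ Finset.range m, ∑ x ∈ Finset.Ico 1 (N - 1), |h (x + 1) - h x| := by
          refine Finset.sum_le_sum fun j _ => ?_
          rw [← Finset.sum_filter]
          rw [← Finset.sum_image (f := fun x => |h (x + 1) - h x|) (g := fun x => x + j)
            (fun x _ y _ hxy => by simpa using hxy)]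
          refine Finset.sum_le_sum_of_subset_of_nonneg ?_ fun _ _ _ => abs_nonneg _
          intro y hy
          obtain ⟨x, hx, rfl⟩ := Finset.mem_image.1 hy
          exact (Finset.mem_filter.1 hx).2
      _ = m * ∑ x ∈ Finset.Ico 1 (N - 1), |h (x + 1) - h x| := by simp
  rcases Int.eq_nat_or_neg a with ⟨m, rfl | rfl⟩
  · simpa using hpos m
  · rw [Finset.sum_comm]
    have e : ∀ x z : ℕ, (if (z : ℤ) - (x : ℤ) = -(m : ℤ) then |h z - h x| else 0) =
        (if (x : ℤ) - (z : ℤ) = m then |h x - h z| else 0) := fun x z => by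
      rw [abs_sub_comm]
      exact if_congr (by omega) rfl rfl
    simp only [e]
    simpa using hpos m

open Classical in
/-- The cost of a displacement `y` for the test function `g ⊗ h`: the normal part is paid by the
total variation of `h`, the tangential part by the Lipschitz constant of `g` at mesh `1 / N`. -/
theorem sum_sum_leads_le {K : ℝ} {g : Torus n → ℝ} (hg : SmoothBound K g) (h : ℕ → ℝ)
    (y : Fin (n + 1) → ℤ) :
    ∑ x : Site n N, ∑ z, (if Leads x z y then |g (scaled z) * h z.1 - g (scaled x) * h x.1| else 0) ≤
      (N : ℝ) ^ n * (K * (∑ i, |(y i : ℝ)|) * (∑ x ∈ Finset.Ico 1 (N - 1), |h (x + 1) - h x| +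
        (∑ x ∈ Finset.Ico 1 N, |h x|) / N)) := by
  set A := ∑ x ∈ Finset.Ico 1 N, |h x| with hA
  set B := ∑ x ∈ Finset.Ico 1 (N - 1), |h (x + 1) - h x| with hB
  set Y := ∑ i, |(y i : ℝ)| with hY
  have hK : 0 ≤ K := (norm_nonneg _).trans (hg.bound 0)
  have hA0 : 0 ≤ A := Finset.sum_nonneg fun _ _ => abs_nonneg _
  have hB0 : 0 ≤ B := Finset.sum_nonneg fun _ _ => abs_nonneg _
  have hY' : Y = |(y 0 : ℝ)| + ∑ i : Fin n, |(y i.succ : ℝ)| := by rw [hY, Fin.sum_univ_succ]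
  have hYs : 0 ≤ ∑ i : Fin n, |(y i.succ : ℝ)| := Finset.sum_nonneg fun _ _ => abs_nonneg _
  set D : ℝ := K * ((∑ i : Fin n, |(y i.succ : ℝ)|) / N) with hD
  have hD0 : 0 ≤ D := by positivity
  have hpt : ∀ (x : Site n N) (z₁ : ↥(Finset.Ico 1 N)),
      |g (scaled (z₁, translate x.2 fun i => y i.succ)) * h z₁ - g (scaled x) * h x.1| ≤
        K * |h z₁ - h x.1| + D * |h x.1| := by
    intro x z₁
    have e2 : scaled (z₁, translate x.2 fun i => y i.succ) =
      scaled x + Torus.mk fun i => (y i.succ : ℝ) / N := scaledT_translate x.2 _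
    rw [e2]
    set u := scaled x
    set b := Torus.mk fun i : Fin n => (y i.succ : ℝ) / N with hb
    have e3 : g (u + b) * h z₁ - g u * h x.1 =
        g (u + b) * (h z₁ - h x.1) + (g (u + b) - g u) * h x.1 := by ring
    rw [e3]
    refine (abs_add_le _ _).trans (add_le_add ?_ ?_)
    · rw [abs_mul]
      exact mul_le_mul_of_nonneg_right (hg.bound _) (abs_nonneg _)
    · rw [abs_mul]
      refine mul_le_mul_of_nonneg_right ((hg.lip u _).trans_eq ?_) (abs_nonneg _)
      rw [hD, Finset.sum_div]
      simp only [abs_div, Nat.abs_cast]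
  calc ∑ x : Site n N, ∑ z, (if Leads x z y then
        |g (scaled z) * h z.1 - g (scaled x) * h x.1| else 0)
      ≤ ∑ x : Site n N, ∑ z₁ : ↥(Finset.Ico 1 N), (if ((z₁ : ℕ) : ℤ) - ((x.1 : ℕ) : ℤ) = y 0 then
          K * |h z₁ - h x.1| + D * |h x.1| else 0) := by
        refine Finset.sum_le_sum fun x _ => ?_
        rw [sum_leads]
        refine Finset.sum_le_sum fun z₁ _ => ?_
        split_ifs
        · exact hpt x z₁
        · exact le_rfl
    _ = (N : ℝ) ^ n * ∑ x ∈ Finset.Ico 1 N, ∑ z ∈ Finset.Ico 1 N,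
          (if (z : ℤ) - (x : ℤ) = y 0 then K * |h z - h x| + D * |h x| else 0) := by
        rw [Fintype.sum_prod_type, ← sum_Ico_subtype, Finset.mul_sum]
        refine Finset.sum_congr rfl fun x _ => ?_
        rw [← sum_Ico_subtype]
        simp
    _ ≤ (N : ℝ) ^ n * (K * (|(y 0 : ℝ)| * B) + D * A) := by
        refine mul_le_mul_of_nonneg_left ?_ (by positivity)
        have e : ∀ x z : ℕ, (if (z : ℤ) - (x : ℤ) = y 0 then K * |h z - h x| + D * |h x| else 0) =
            K * (if (z : ℤ) - (x : ℤ) = y 0 then |h z - h x| else 0) +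
              D * (if (z : ℤ) - (x : ℤ) = y 0 then |h x| else 0) := fun x z => by
          split_ifs <;> simp
        simp only [e, Finset.sum_add_distrib, ← Finset.mul_sum]
        refine add_le_add (mul_le_mul_of_nonneg_left (sum_abs_increment_le h _) hK)
          (mul_le_mul_of_nonneg_left (Finset.sum_le_sum fun x _ => ?_) hD0)
        by_cases hz : ∃ z : ℕ, (z : ℤ) - (x : ℤ) = y 0
        · obtain ⟨z, hz⟩ := hz
          have e1 : ∀ w : ℕ, ((w : ℤ) - (x : ℤ) = y 0) = (w = z) := fun w => propext (by omega)
          simp only [e1, Finset.sum_ite_eq']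
          split_ifs
          · exact le_rfl
          · exact abs_nonneg _
        · have e1 : ∀ w : ℕ, ¬ ((w : ℤ) - (x : ℤ) = y 0) := fun w hw => hz ⟨w, hw⟩
          simp [e1]
    _ ≤ _ := by
        refine mul_le_mul_of_nonneg_left ?_ (by positivity)
        have e : K * Y * (B + A / N) - (K * (|(y 0 : ℝ)| * B) + D * A) =
            K * ((∑ i : Fin n, |(y i.succ : ℝ)|) * B + |(y 0 : ℝ)| * (A / N)) := by
          rw [hY', hD]; ring
        have : 0 ≤ K * ((∑ i : Fin n, |(y i.succ : ℝ)|) * B + |(y 0 : ℝ)| * (A / N)) := by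
          positivity
        linarith

end Displacement

/-! ### The generator on the test functions -/

/-- Under symmetric rates the exclusion rule is invisible to linear functions. -/
theorem sum_exclusion_of_symm {S : Type*} [Fintype S] (o H : S → ℝ) (s : S → S → ℝ)
    (hs : ∀ x z, s x z = s z x) :
    ∑ x, ∑ z, o x * (1 - o z) * s x z * (H z - H x) = ∑ x, o x * ∑ z, s x z * (H z - H x) := by
  have h0 : ∑ x, ∑ z, o x * o z * s x z * (H z - H x) = 0 := by
    have h1 : ∑ x, ∑ z, o x * o z * s x z * (H z - H x) =
        -∑ x, ∑ z, o x * o z * s x z * (H z - H x) := by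
      conv_lhs => rw [Finset.sum_comm]
      rw [← Finset.sum_neg_distrib]
      refine Finset.sum_congr rfl fun x _ => ?_
      rw [← Finset.sum_neg_distrib]
      refine Finset.sum_congr rfl fun z _ => ?_
      rw [hs z x]; ring
    linarith
  have h2 : ∑ x, o x * ∑ z, s x z * (H z - H x) = ∑ x, ∑ z, o x * (1 - o z) * s x z * (H z - H x) +
      ∑ x, ∑ z, o x * o z * s x z * (H z - H x) := by
    rw [← Finset.sum_add_distrib]
    refine Finset.sum_congr rfl fun x _ => ?_
    rw [← Finset.sum_add_distrib, Finset.mul_sum]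
    exact Finset.sum_congr rfl fun z _ => by ring
  rw [h2, h0, add_zero]

namespace Model
variable {n : ℕ} {M : Model n} {N : ℕ}

open Classical in
/-- The jump rates split into a symmetric nearest-neighbour part and the weak asymmetry. -/
theorem jumpRate_eq (x z : Site n N) (v : M.vel) :
    M.jumpRate x z v =
      1 / 2 * ∑ j : Fin (n + 1), ((if Leads x z (Pi.single j 1) then 1 else 0) +
        (if Leads x z (Pi.single j (-1)) then 1 else 0)) +
      1 / (N : ℝ) * (M.p v).sum fun y a => a * if Leads x z y then 1 else 0 := by
  have h1 : M.jumpRate x z v =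
      Finsupp.linearCombination ℝ (fun y => if Leads x z y then (1 : ℝ) else 0) (M.P N v) := by
    rw [Finsupp.linearCombination_apply, jumpRate]
    refine Finsupp.sum_congr fun y _ => ?_
    rw [smul_eq_mul, mul_ite, mul_one, mul_zero]
    exact if_congr Iff.rfl rfl rfl
  rw [h1, P, map_add, map_smul, map_smul, map_sum]
  simp only [map_add, Finsupp.linearCombination_single, one_mul, smul_eq_mul]
  rw [Finsupp.linearCombination_apply]
  simp only [smul_eq_mul]

/-- The sum of `|v_k|` over the velocities, which bounds `|I_k|`. -/
def compNorm (M : Model n) (k : Fin (n + 2)) : ℝ := ∑ v : M.vel, |comp v k|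

theorem compNorm_nonneg (k : Fin (n + 2)) : 0 ≤ M.compNorm k :=
  Finset.sum_nonneg fun _ _ => abs_nonneg _

/-- A bound on the first absolute moments of the jump distributions. -/
def jumpMoment (M : Model n) : ℝ := ∑ v : M.vel, (M.p v).sum fun y a => a * ∑ i, |(y i : ℝ)|

theorem jumpMoment_term_nonneg (v : M.vel) :
    0 ≤ (M.p v).sum fun y a => a * ∑ i, |(y i : ℝ)| :=
  Finsupp.sum_nonneg fun y _ => mul_nonneg (M.p_nonneg v y) (Finset.sum_nonneg fun _ _ => abs_nonneg _)

theorem le_jumpMoment (v : M.vel) :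
    ((M.p v).sum fun y a => a * ∑ i, |(y i : ℝ)|) ≤ M.jumpMoment :=
  Finset.single_le_sum (f := fun v : M.vel => (M.p v).sum fun y a => a * ∑ i, |(y i : ℝ)|)
    (fun v _ => jumpMoment_term_nonneg v) (Finset.mem_univ v)

theorem jumpMoment_nonneg : 0 ≤ M.jumpMoment :=
  Finset.sum_nonneg fun v _ => jumpMoment_term_nonneg v

theorem abs_I_le (k : Fin (n + 2)) (η : M.Config N) (x : Site n N) : |I k η x| ≤ M.compNorm k := by
  refine (Finset.abs_sum_le_sum_abs _ _).trans (Finset.sum_le_sum fun v _ => ?_)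
  rw [abs_mul, abs_of_nonneg (occ_nonneg η x v)]
  exact mul_le_of_le_one_right (abs_nonneg _) (occ_le_one η x v)

open Classical in
/-- Up to the weakly asymmetric jumps of rate `p / N`, the exclusion acts on test functions as a
discrete Laplacian. -/
theorem genEx_testObs_sub_le {K : ℝ} {g : Torus n → ℝ} (hg : SmoothBound K g) (h : ℕ → ℝ)
    (k : Fin (n + 2)) (η : M.Config N) :
    |M.genEx (testObs k g h) η - 1 / (N : ℝ) ^ n * (1 / 2 * ∑ x : Site n N,
      (g (scaled x) * lap N h x.1 + h x.1 * tangLap N g (scaled x)) * I k η x)| ≤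
    1 / (N : ℝ) * (1 / (N : ℝ) ^ n * ((N : ℝ) ^ n * (M.compNorm k * (K * M.jumpMoment *
      (∑ x ∈ Finset.Ico 1 (N - 1), |h (x + 1) - h x| + (∑ x ∈ Finset.Ico 1 N, |h x|) / N))))) := by
  set H : Site n N → ℝ := fun x => g (scaled x) * h x.1 with hH
  set c : ℝ := 1 / (N : ℝ) ^ n with hc
  have hc0 : 0 ≤ c := by positivity
  set T : ℝ := ∑ x ∈ Finset.Ico 1 (N - 1), |h (x + 1) - h x| + (∑ x ∈ Finset.Ico 1 N, |h x|) / N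
    with hT
  have hK : 0 ≤ K := (norm_nonneg _).trans (hg.bound 0)
  have hT0 : 0 ≤ T := by
    have h1 : 0 ≤ ∑ x ∈ Finset.Ico 1 (N - 1), |h (x + 1) - h x| :=
      Finset.sum_nonneg fun _ _ => abs_nonneg _
    have h2 : 0 ≤ ∑ x ∈ Finset.Ico 1 N, |h x| := Finset.sum_nonneg fun _ _ => abs_nonneg _
    positivity
  let ind : Site n N → Site n N → (Fin (n + 1) → ℤ) → ℝ := fun x z y => if Leads x z y then 1 else 0
  let s : Site n N → Site n N → ℝ := fun x z =>
    ∑ j : Fin (n + 1), (ind x z (Pi.single j 1) + ind x z (Pi.single j (-1)))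
  have hs : ∀ x z, s x z = s z x := by
    intro x z
    refine Finset.sum_congr rfl fun j _ => ?_
    rw [add_comm]
    have e1 : ∀ a : ℤ, ind x z (Pi.single j (-a)) = ind z x (Pi.single j a) := fun a => by
      have : (Pi.single j (-a) : Fin (n + 1) → ℤ) = -Pi.single j a := by
        funext i
        by_cases hi : i = j
        · subst hi; simp
        · simp [hi]
      simp only [ind, this]
      exact if_congr (leads_neg z x _) rfl rfl
    have e2 := e1 (-1)
    rw [neg_neg] at e2
    rw [e1 1, e2]
  let R : M.vel → ℝ := fun v => ∑ x, ∑ z, occ η x v * (1 - occ η z v) *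
    ((M.p v).sum fun y a => a * ind x z y) * (H z - H x)
  have hsplit : M.genEx (testObs k g h) η = ∑ v, c * comp v k * (1 / 2 * ∑ x, occ η x v *
      (g (scaled x) * lap N h x.1 + h x.1 * tangLap N g (scaled x)) + 1 / (N : ℝ) * R v) := by
    rw [testObs, genEx_linearObs]
    refine Finset.sum_congr rfl fun v _ => ?_
    have h2 : ∑ x, occ η x v * (g (scaled x) * lap N h x.1 + h x.1 * tangLap N g (scaled x)) =
        ∑ x, ∑ z, occ η x v * (1 - occ η z v) * s x z * (H z - H x) := by
      rw [sum_exclusion_of_symm (fun x => occ η x v) H s hs]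
      refine Finset.sum_congr rfl fun x _ => ?_
      congr 1
      rw [← sum_nearest_neighbour, Finset.sum_comm]
      refine Finset.sum_congr rfl fun z _ => ?_
      simp only [s, Finset.sum_mul]
      refine Finset.sum_congr rfl fun j _ => ?_
      simp only [ind, add_mul, ite_mul, one_mul, zero_mul, hH]
    rw [h2]
    simp only [R, Finset.mul_sum, ← Finset.sum_add_distrib]
    refine Finset.sum_congr rfl fun x _ => Finset.sum_congr rfl fun z _ => ?_
    rw [jumpRate_eq]
    simp only [s, ind, hH]
    ring
  have hR : ∀ v, |R v| ≤ (N : ℝ) ^ n * (K * M.jumpMoment * T) := by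
    intro v
    calc |R v| ≤ ∑ x, ∑ z, ((M.p v).sum fun y a => a * ind x z y) * |H z - H x| := by
          refine (Finset.abs_sum_le_sum_abs _ _).trans (Finset.sum_le_sum fun x _ =>
            (Finset.abs_sum_le_sum_abs _ _).trans (Finset.sum_le_sum fun z _ => ?_))
          have hi : 0 ≤ (M.p v).sum fun y a => a * ind x z y :=
            Finsupp.sum_nonneg fun y _ => mul_nonneg (M.p_nonneg v y) (by
              simp only [ind]; split_ifs <;> norm_num)
          rw [abs_mul, abs_mul, abs_mul, abs_of_nonneg hi, abs_of_nonneg (occ_nonneg η x v),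
            abs_of_nonneg (sub_nonneg.2 (occ_le_one η z v))]
          refine mul_le_mul_of_nonneg_right (mul_le_of_le_one_left hi ?_) (abs_nonneg _)
          exact mul_le_one₀ (occ_le_one η x v) (sub_nonneg.2 (occ_le_one η z v))
            (by linarith [occ_nonneg η z v])
      _ = ∑ y ∈ (M.p v).support, M.p v y * ∑ x, ∑ z, (if Leads x z y then |H z - H x| else 0) := by
          simp only [Finsupp.sum, Finset.sum_mul, Finset.mul_sum]
          rw [Finset.sum_comm]
          conv_lhs => enter [2, x]; rw [Finset.sum_comm]
          rw [Finset.sum_comm]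
          refine Finset.sum_congr rfl fun y _ => ?_
          rw [Finset.sum_comm]
          refine Finset.sum_congr rfl fun x _ => Finset.sum_congr rfl fun z _ => ?_
          simp only [ind]; split_ifs <;> ring
      _ ≤ ∑ y ∈ (M.p v).support, M.p v y * ((N : ℝ) ^ n * (K * (∑ i, |(y i : ℝ)|) * T)) :=
          Finset.sum_le_sum fun y _ =>
            mul_le_mul_of_nonneg_left (sum_sum_leads_le hg h y) (M.p_nonneg v y)
      _ = (N : ℝ) ^ n * (K * ((M.p v).sum fun y a => a * ∑ i, |(y i : ℝ)|) * T) := by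
          simp only [Finsupp.sum, Finset.mul_sum, Finset.sum_mul]
          refine Finset.sum_congr rfl fun y _ => ?_
          refine Finset.sum_congr rfl fun i _ => ?_
          ring
      _ ≤ _ := by
          refine mul_le_mul_of_nonneg_left ?_ (by positivity)
          exact mul_le_mul_of_nonneg_right (mul_le_mul_of_nonneg_left (le_jumpMoment v) hK) hT0
  have hmain : M.genEx (testObs k g h) η - c * (1 / 2 * ∑ x : Site n N,
      (g (scaled x) * lap N h x.1 + h x.1 * tangLap N g (scaled x)) * I k η x) =
      ∑ v, c * comp v k * (1 / (N : ℝ) * R v) := by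
    have key : ∀ L : Site n N → ℝ, ∑ v, c * comp v k * (1 / 2 * ∑ x, occ η x v * L x) =
        c * (1 / 2 * ∑ x, L x * I k η x) := by
      intro L
      simp only [I, Finset.mul_sum]
      rw [Finset.sum_comm]
      refine Finset.sum_congr rfl fun x _ => Finset.sum_congr rfl fun v _ => ?_
      ring
    rw [hsplit, sub_eq_iff_eq_add, ← key, ← Finset.sum_add_distrib]
    refine Finset.sum_congr rfl fun v _ => ?_
    ring
  rw [hmain]
  calc |∑ v, c * comp v k * (1 / (N : ℝ) * R v)|
      ≤ ∑ v, |comp v k| * (1 / (N : ℝ) * (c * ((N : ℝ) ^ n * (K * M.jumpMoment * T)))) := by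
        refine (Finset.abs_sum_le_sum_abs _ _).trans (Finset.sum_le_sum fun v _ => ?_)
        rw [abs_mul, abs_mul, abs_mul, abs_of_nonneg hc0, abs_of_nonneg (by positivity : 0 ≤ 1 / (N : ℝ))]
        calc c * |comp v k| * (1 / (N : ℝ) * |R v|)
            ≤ c * |comp v k| * (1 / (N : ℝ) * ((N : ℝ) ^ n * (K * M.jumpMoment * T))) := by
              gcongr; exact hR v
          _ = _ := by ring
    _ = _ := by rw [← Finset.sum_mul, ← compNorm]; ring

/-- The generator on `testObs k g h`: the reservoirs produce the boundary fluctuations, the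
symmetric exclusion produces the Laplacian of `h`, and everything else is controlled by the
`ℓ¹` norm and the total variation of `h`. -/
theorem gen_testObs_sub_le {K : ℝ} {g : Torus n → ℝ} (hg : SmoothBound K g) (h : ℕ → ℝ)
    (k : Fin (n + 2)) (θ : ℝ) (hN : 1 ≤ N) (η : M.Config N) :
    |M.gen θ (testObs k g h) η -
      ((N : ℝ) ^ 2 * -(1 / (N : ℝ) ^ θ * (h 1 * M.V1left k g η + h (N - 1) * M.V1right k g η)) +
        (N : ℝ) ^ 2 / 2 * (1 / (N : ℝ) ^ n * ∑ x : Site n N, g (scaled x) * lap N h x.1 * I k η x))| ≤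
    K * M.compNorm k * (n + M.jumpMoment) *
      (N * ∑ x ∈ Finset.Ico 1 (N - 1), |h (x + 1) - h x| + ∑ x ∈ Finset.Ico 1 N, |h x|) := by
  have hN0 : (N : ℝ) ≠ 0 := by positivity
  have hK : 0 ≤ K := (norm_nonneg _).trans (hg.bound 0)
  set A := ∑ x ∈ Finset.Ico 1 N, |h x| with hA
  set B := ∑ x ∈ Finset.Ico 1 (N - 1), |h (x + 1) - h x| with hB
  have hA0 : 0 ≤ A := Finset.sum_nonneg fun _ _ => abs_nonneg _
  have hB0 : 0 ≤ B := Finset.sum_nonneg fun _ _ => abs_nonneg _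
  have hS := M.compNorm_nonneg k
  have hJ := M.jumpMoment_nonneg
  have hEx := genEx_testObs_sub_le hg h k η
  have hColl : M.genColl (testObs k g h) η = 0 := genColl_linearObs _ k η
  set c : ℝ := 1 / (N : ℝ) ^ n with hc
  have hc0 : 0 ≤ c := by positivity
  have hcN : c * (N : ℝ) ^ n = 1 := by rw [hc]; field_simp
  rw [← mul_assoc c ((N : ℝ) ^ n), hcN, one_mul] at hEx
  set Tg : ℝ := ∑ x : Site n N, h x.1 * tangLap N g (scaled x) * I k η x with hTg
  have hTgb : |c * Tg| ≤ n * (K * (1 / (N : ℝ)) ^ 2) * M.compNorm k * A := by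
    have h1 : |Tg| ≤ (N : ℝ) ^ n * (n * (K * (1 / (N : ℝ)) ^ 2) * M.compNorm k * A) := by
      calc |Tg| ≤ ∑ x : Site n N, |h x.1| * (n * (K * (1 / (N : ℝ)) ^ 2)) * M.compNorm k := by
            refine (Finset.abs_sum_le_sum_abs _ _).trans (Finset.sum_le_sum fun x _ => ?_)
            rw [abs_mul, abs_mul]
            gcongr
            · exact abs_tangLap_le hg _
            · exact abs_I_le k η x
        _ = _ := by
            rw [sum_site_normal fun x => |h x| * (n * (K * (1 / (N : ℝ)) ^ 2)) * M.compNorm k, hA,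
              ← Finset.sum_mul, ← Finset.sum_mul]
            ring
    rw [abs_mul, abs_of_nonneg hc0]
    calc c * |Tg| ≤ c * ((N : ℝ) ^ n * (n * (K * (1 / (N : ℝ)) ^ 2) * M.compNorm k * A)) := by gcongr
      _ = _ := by rw [← mul_assoc, hcN, one_mul]
  have hsum : ∑ x : Site n N, (g (scaled x) * lap N h x.1 + h x.1 * tangLap N g (scaled x)) *
      I k η x = ∑ x : Site n N, g (scaled x) * lap N h x.1 * I k η x + Tg := by
    rw [hTg, ← Finset.sum_add_distrib]
    exact Finset.sum_congr rfl fun x _ => by ring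
  rw [hsum] at hEx
  rw [gen, genGlauber_testObs, hColl, add_zero]
  set E := M.genEx (testObs k g h) η
  set L := ∑ x : Site n N, g (scaled x) * lap N h x.1 * I k η x
  set G := -(1 / (N : ℝ) ^ θ * (h 1 * M.V1left k g η + h (N - 1) * M.V1right k g η))
  have e : (N : ℝ) ^ 2 * (G + E) - ((N : ℝ) ^ 2 * G + (N : ℝ) ^ 2 / 2 * (c * L)) =
      (N : ℝ) ^ 2 * (E - c * (1 / 2 * (L + Tg))) + (N : ℝ) ^ 2 / 2 * (c * Tg) := by ring
  rw [e]
  refine (abs_add_le _ _).trans ?_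
  rw [abs_mul, abs_mul ((N : ℝ) ^ 2 / 2), abs_of_nonneg (by positivity : 0 ≤ (N : ℝ) ^ 2),
    abs_of_nonneg (by positivity : 0 ≤ (N : ℝ) ^ 2 / 2)]
  have h3 : (N : ℝ) ^ 2 * |E - c * (1 / 2 * (L + Tg))| ≤
      M.compNorm k * (K * M.jumpMoment * (N * B + A)) := by
    calc _ ≤ (N : ℝ) ^ 2 * (1 / (N : ℝ) * (M.compNorm k * (K * M.jumpMoment * (B + A / N)))) := by
          gcongr
      _ = _ := by field_simp
  have h4 : (N : ℝ) ^ 2 / 2 * |c * Tg| ≤ K * M.compNorm k * n * A := by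
    calc _ ≤ (N : ℝ) ^ 2 / 2 * (n * (K * (1 / (N : ℝ)) ^ 2) * M.compNorm k * A) := by gcongr
      _ = K * M.compNorm k * n * A / 2 := by field_simp
      _ ≤ _ := half_le_self (by positivity)
  have h5 : 0 ≤ K * M.compNorm k * n * (N * B) := by positivity
  nlinarith

theorem abs_testObs_le {K : ℝ} {g : Torus n → ℝ} (hg : SmoothBound K g) (h : ℕ → ℝ)
    (k : Fin (n + 2)) (η : M.Config N) (hN : 1 ≤ N) :
    |testObs k g h η| ≤ K * M.compNorm k * ∑ x ∈ Finset.Ico 1 N, |h x| := by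
  have hK : 0 ≤ K := (norm_nonneg _).trans (hg.bound 0)
  have hN0 : (N : ℝ) ≠ 0 := by positivity
  have e : testObs k g h η = ∑ x : Site n N, 1 / (N : ℝ) ^ n * (g (scaled x) * h x.1) * I k η x := by
    simp only [testObs, linearObs, I, Finset.mul_sum, mul_assoc]
  rw [e]
  calc _ ≤ ∑ x : Site n N, 1 / (N : ℝ) ^ n * (K * |h x.1|) * M.compNorm k := by
        refine (Finset.abs_sum_le_sum_abs _ _).trans (Finset.sum_le_sum fun x _ => ?_)
        rw [abs_mul, abs_mul, abs_mul, abs_of_nonneg (by positivity : 0 ≤ 1 / (N : ℝ) ^ n)]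
        gcongr
        · exact hg.bound _
        · exact abs_I_le k η x
    _ = _ := by
        rw [sum_site_normal fun x => 1 / (N : ℝ) ^ n * (K * |h x|) * M.compNorm k, ← Finset.sum_mul,
          ← Finset.mul_sum, ← Finset.mul_sum]
        field_simp

end Model

/-! ### Profiles in the normal direction -/

theorem lap_affine {N : ℕ} (hN : 3 ≤ N) {h : ℕ → ℝ} {b σ : ℝ} (hh : ∀ x : ℕ, h x = b + σ * x) {x : ℕ}
    (hx : x ∈ Finset.Ico 1 N) :
    lap N h x = σ * ((if x = 1 then 1 else 0) - (if x = N - 1 then 1 else 0)) := by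
  have hx := Finset.mem_Ico.1 hx
  simp only [lap, hh]
  have c1 : 1 < x → ((x - 1 : ℕ) : ℝ) = x - 1 := fun h => by
    rw [Nat.cast_sub h.le, Nat.cast_one]
  by_cases h1 : x = 1
  · subst h1
    rw [if_pos (by omega), if_neg (by omega), if_pos rfl, if_neg (by omega)]
    push_cast; ring
  · have h2 : 1 < x := by omega
    by_cases h3 : x = N - 1
    · rw [if_neg (by omega), if_pos h2, if_neg h1, if_pos h3, c1 h2]; ring
    · rw [if_pos (by omega), if_pos h2, if_neg h1, if_neg h3, c1 h2]; push_cast; ring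

/-- The Green function of the Dirichlet problem on `{1, …, N-1}`: it vanishes at both ends and has
a downward kink at `y`. -/
def green (N y x : ℕ) : ℝ := min (x : ℝ) y - 1 - ((x : ℝ) - 1) * ((y : ℝ) - 1) / ((N : ℝ) - 2)

theorem green_of_le {N y x : ℕ} (h : x ≤ y) :
    green N y x = x - 1 - ((x : ℝ) - 1) * ((y : ℝ) - 1) / ((N : ℝ) - 2) := by
  rw [green, min_eq_left (by exact_mod_cast h)]

theorem green_of_ge {N y x : ℕ} (h : y ≤ x) :
    green N y x = y - 1 - ((x : ℝ) - 1) * ((y : ℝ) - 1) / ((N : ℝ) - 2) := by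
  rw [green, min_eq_right (by exact_mod_cast h)]

/-- The value of the Green function at its peak. -/
def greenPeak (N y : ℕ) : ℝ := ((y : ℝ) - 1) * ((N : ℝ) - 1 - y) / ((N : ℝ) - 2)

section
variable {N : ℕ}

theorem green_one {y : ℕ} (hy : 1 ≤ y) : green N y 1 = 0 := by
  rw [green_of_le hy]; simp

theorem green_last (hN : 3 ≤ N) {y : ℕ} (hy : y ∈ Finset.Ico 1 N) : green N y (N - 1) = 0 := by
  have hy := Finset.mem_Ico.1 hy
  have h3 : (3 : ℝ) ≤ N := by exact_mod_cast hN
  have : (N : ℝ) - 2 ≠ 0 := by linarith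
  rw [green_of_ge (by omega), Nat.cast_sub (by omega)]
  push_cast
  field_simp
  ring

theorem abs_green_le (hN : 3 ≤ N) {x y : ℕ} (hx : x ∈ Finset.Ico 1 N) (hy : y ∈ Finset.Ico 1 N) :
    |green N y x| ≤ greenPeak N y := by
  have hx := Finset.mem_Ico.1 hx
  have hy := Finset.mem_Ico.1 hy
  have h3 : (3 : ℝ) ≤ N := by exact_mod_cast hN
  have hL : 0 < (N : ℝ) - 2 := by linarith
  have hx1 : (1 : ℝ) ≤ x := by exact_mod_cast hx.1
  have hy1 : (1 : ℝ) ≤ y := by exact_mod_cast hy.1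
  have hx2 : (x : ℝ) + 1 ≤ N := by exact_mod_cast hx.2
  have hy2 : (y : ℝ) + 1 ≤ N := by exact_mod_cast hy.2
  rcases le_total x y with h | h
  · have h' : (x : ℝ) ≤ y := by exact_mod_cast h
    have e : green N y x = ((x : ℝ) - 1) * ((N : ℝ) - 1 - y) / ((N : ℝ) - 2) := by
      rw [green_of_le h]; field_simp; ring
    rw [e, abs_of_nonneg (div_nonneg (mul_nonneg (by linarith) (by linarith)) hL.le), greenPeak]
    gcongr
    linarith
  · have h' : (y : ℝ) ≤ x := by exact_mod_cast h
    have e : green N y x = ((y : ℝ) - 1) * ((N : ℝ) - 1 - x) / ((N : ℝ) - 2) := by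
      rw [green_of_ge h]; field_simp; ring
    rw [e, abs_of_nonneg (div_nonneg (mul_nonneg (by linarith) (by linarith)) hL.le), greenPeak]
    gcongr

/-- The total variation: the Green function increases to its peak at `y` and decreases after it. -/
theorem sum_abs_green_increment (hN : 3 ≤ N) {y : ℕ} (hy : y ∈ Finset.Ico 1 N) :
    ∑ x ∈ Finset.Ico 1 (N - 1), |green N y (x + 1) - green N y x| = 2 * greenPeak N y := by
  have hy := Finset.mem_Ico.1 hy
  have h3 : (3 : ℝ) ≤ N := by exact_mod_cast hN
  have hL : 0 < (N : ℝ) - 2 := by linarith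
  have hy1 : (1 : ℝ) ≤ y := by exact_mod_cast hy.1
  have hy2 : (y : ℝ) + 1 ≤ N := by exact_mod_cast hy.2
  rw [← Finset.sum_Ico_consecutive _ hy.1 (by omega : y ≤ N - 1)]
  have e1 : ∀ x ∈ Finset.Ico 1 y, |green N y (x + 1) - green N y x| =
      ((N : ℝ) - 1 - y) / ((N : ℝ) - 2) := by
    intro x hx
    have hx := Finset.mem_Ico.1 hx
    have e : green N y (x + 1) - green N y x = ((N : ℝ) - 1 - y) / ((N : ℝ) - 2) := by
      rw [green_of_le (by omega), green_of_le (by omega)]; push_cast; field_simp; ring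
    rw [e, abs_of_nonneg (div_nonneg (by linarith) hL.le)]
  have e2 : ∀ x ∈ Finset.Ico y (N - 1), |green N y (x + 1) - green N y x| =
      ((y : ℝ) - 1) / ((N : ℝ) - 2) := by
    intro x hx
    have hx := Finset.mem_Ico.1 hx
    have e : green N y (x + 1) - green N y x = -(((y : ℝ) - 1) / ((N : ℝ) - 2)) := by
      rw [green_of_ge (by omega), green_of_ge (by omega)]; push_cast; field_simp; ring
    rw [e, abs_neg, abs_of_nonneg (div_nonneg (by linarith) hL.le)]
  rw [Finset.sum_congr rfl e1, Finset.sum_congr rfl e2]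
  simp only [Finset.sum_const, Nat.card_Ico, nsmul_eq_mul]
  rw [Nat.cast_sub hy.1, Nat.cast_sub (by omega), Nat.cast_sub (by omega), greenPeak]
  push_cast
  ring

/-- Besides the downward kink at `y`, the reflected Laplacian sees the slopes of the Green function at
both ends. -/
theorem lap_green (hN : 3 ≤ N) {x y : ℕ} (hx : x ∈ Finset.Ico 1 N) (hy : y ∈ Finset.Ico 1 N) :
    lap N (green N y) x = (if x = 1 then 1 else 0) - (if x = y then 1 else 0) +
      ((y : ℝ) - 1) / ((N : ℝ) - 2) * ((if x = N - 1 then 1 else 0) - (if x = 1 then 1 else 0)) := by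
  have hx := Finset.mem_Ico.1 hx
  have hy := Finset.mem_Ico.1 hy
  have h3 : (3 : ℝ) ≤ N := by exact_mod_cast hN
  have hL : (N : ℝ) - 2 ≠ 0 := by linarith
  have c1 : 1 < x → ((x - 1 : ℕ) : ℝ) = x - 1 := fun h => by
    rw [Nat.cast_sub h.le, Nat.cast_one]
  set σ : ℝ := ((y : ℝ) - 1) / ((N : ℝ) - 2) with hσ
  have inc1 : ∀ x : ℕ, x < y → green N y (x + 1) - green N y x = 1 - σ := fun x h => by
    rw [green_of_le (by omega), green_of_le (by omega), hσ]; push_cast; ring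
  have inc2 : ∀ x : ℕ, y ≤ x → green N y (x + 1) - green N y x = -σ := fun x h => by
    rw [green_of_ge (by omega), green_of_ge (by omega), hσ]; push_cast; ring
  have back : 1 < x → green N y (x - 1) - green N y x = if x ≤ y then σ - 1 else σ := fun h => by
    obtain ⟨w, rfl⟩ : ∃ w, x = w + 1 := ⟨x - 1, by omega⟩
    rw [Nat.add_sub_cancel]
    split_ifs with hw
    · have := inc1 w (by omega); linarith
    · have := inc2 w (by omega); linarith
  have fwd : green N y (x + 1) - green N y x = if x < y then 1 - σ else -σ := by
    split_ifs with hw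
    · exact inc1 x hw
    · exact inc2 x (by omega)
  rw [lap, fwd]
  by_cases h1 : x = 1
  · rw [if_neg (by omega : ¬ 1 < x), if_pos h1, if_neg (by omega : ¬ x = N - 1),
      if_pos (by omega : x + 1 < N)]
    by_cases h4 : x = y
    · rw [if_neg (by omega), if_pos h4]; ring
    · rw [if_pos (by omega), if_neg h4]; ring
  · have h2 : 1 < x := by omega
    rw [if_pos h2, back h2, if_neg h1]
    by_cases h5 : x = N - 1
    · rw [if_neg (by omega : ¬ x + 1 < N), if_pos h5]
      by_cases h4 : x = y
      · rw [if_pos (by omega), if_pos h4]; ring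
      · rw [if_neg (by omega), if_neg h4]; ring
    · rw [if_pos (by omega : x + 1 < N), if_neg h5]
      rcases lt_trichotomy x y with h4 | h4 | h4
      · rw [if_pos h4, if_pos h4.le, if_neg (by omega)]; ring
      · rw [if_neg (by omega), if_pos h4.le, if_pos h4]; ring
      · rw [if_neg (by omega), if_neg (by omega), if_neg (by omega)]; ring

theorem greenPeak_le_left (hN : 3 ≤ N) {y : ℕ} (hy : y ∈ Finset.Ico 1 N) :
    greenPeak N y ≤ (y : ℝ) - 1 := by
  have hy := Finset.mem_Ico.1 hy
  have h3 : (3 : ℝ) ≤ N := by exact_mod_cast hN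
  have hy1 : (1 : ℝ) ≤ y := by exact_mod_cast hy.1
  rw [greenPeak, div_le_iff₀ (by linarith)]
  exact mul_le_mul_of_nonneg_left (by linarith) (by linarith)

theorem greenPeak_le_right (hN : 3 ≤ N) {y : ℕ} (hy : y ∈ Finset.Ico 1 N) :
    greenPeak N y ≤ (N : ℝ) - 1 - y := by
  have hy := Finset.mem_Ico.1 hy
  have h3 : (3 : ℝ) ≤ N := by exact_mod_cast hN
  have hy2 : (y : ℝ) + 1 ≤ N := by exact_mod_cast hy.2
  rw [greenPeak, div_le_iff₀ (by linarith), mul_comm]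
  exact mul_le_mul_of_nonneg_left (by linarith) (by linarith)

end

namespace Model
variable {n : ℕ} {M : Model n} {N : ℕ}

/-! ### Approximate solutions of the Poisson equation -/

/-- A constant, depending only on the model and on `k`, for the estimates of the approximate solutions
of the Poisson equation. The numbers `13` and `12` are not optimal; they cover both ends and both
kinds of profile. -/
def poissonConst (M : Model n) (k : Fin (n + 2)) : ℝ := M.compNorm k * (13 + 12 * (n + M.jumpMoment))

/-- An affine profile only leaves the reservoir terms. -/
theorem gen_testObs_affine {K : ℝ} {g : Torus n → ℝ} (hg : SmoothBound K g) (k : Fin (n + 2))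
    (θ : ℝ) (hN : 3 ≤ N) {h : ℕ → ℝ} {b σ a : ℝ} (hh : ∀ x : ℕ, h x = b + σ * x)
    (ha : ∀ x ∈ Finset.Ico 1 N, |h x| ≤ a) (hσ : |σ| ≤ a / ((N : ℝ) - 2)) (η : M.Config N) :
    |testObs k g h η| ≤ K * M.poissonConst k * (N * a) ∧
    |M.gen θ (testObs k g h) η -
      (N : ℝ) ^ 2 * -(1 / (N : ℝ) ^ θ * (h 1 * M.V1left k g η + h (N - 1) * M.V1right k g η))| ≤
      K * M.poissonConst k * (N * a) := by
  have h3 : (3 : ℝ) ≤ N := by exact_mod_cast hN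
  have hL : 0 < (N : ℝ) - 2 := by linarith
  have hK : 0 ≤ K := (norm_nonneg _).trans (hg.bound 0)
  have hS := M.compNorm_nonneg k
  have hJ := M.jumpMoment_nonneg
  have ha0 : 0 ≤ a := (abs_nonneg _).trans (ha 1 (Finset.mem_Ico.2 ⟨le_rfl, by omega⟩))
  have hA : ∑ x ∈ Finset.Ico 1 N, |h x| ≤ N * a := by
    refine (Finset.sum_le_card_nsmul _ _ a ha).trans ?_
    rw [Nat.card_Ico, nsmul_eq_mul]
    exact mul_le_mul_of_nonneg_right (by exact_mod_cast Nat.sub_le _ _) ha0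
  have hB : ∑ x ∈ Finset.Ico 1 (N - 1), |h (x + 1) - h x| ≤ a := by
    refine (Finset.sum_le_card_nsmul _ _ (a / ((N : ℝ) - 2)) fun x _ => ?_).trans ?_
    · rw [hh, hh]
      have : b + σ * ((x + 1 : ℕ) : ℝ) - (b + σ * x) = σ := by push_cast; ring
      rwa [this]
    · rw [Nat.card_Ico, nsmul_eq_mul, Nat.sub_sub, Nat.cast_sub (by omega)]
      push_cast
      rw [mul_div_cancel₀ _ hL.ne']
  have hKS : 0 ≤ K * M.compNorm k := by positivity
  constructor
  · refine (abs_testObs_le hg h k η (by omega)).trans ?_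
    calc K * M.compNorm k * ∑ x ∈ Finset.Ico 1 N, |h x| ≤ K * M.compNorm k * (N * a) := by gcongr
      _ ≤ _ := by
        rw [poissonConst, ← mul_assoc K]
        refine mul_le_mul_of_nonneg_right (le_mul_of_one_le_right hKS ?_) (by positivity)
        have : (0 : ℝ) ≤ n := by positivity
        linarith
  · have hgen := gen_testObs_sub_le (M := M) hg h k θ (by omega) η
    set Lp := 1 / (N : ℝ) ^ n * ∑ x : Site n N, g (scaled x) * lap N h x.1 * I k η x with hLp
    have hLpb : |Lp| ≤ K * M.compNorm k * (2 * |σ|) := by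
      rw [hLp, abs_mul, abs_of_nonneg (by positivity : 0 ≤ 1 / (N : ℝ) ^ n)]
      calc _ ≤ 1 / (N : ℝ) ^ n * ∑ x : Site n N, K * (|σ| * ((if (x.1 : ℕ) = 1 then 1 else 0) +
              (if (x.1 : ℕ) = N - 1 then 1 else 0))) * M.compNorm k := by
            refine mul_le_mul_of_nonneg_left ?_ (by positivity)
            refine (Finset.abs_sum_le_sum_abs _ _).trans (Finset.sum_le_sum fun x _ => ?_)
            rw [abs_mul, abs_mul, lap_affine hN hh x.1.2, abs_mul]
            gcongr
            · exact hg.bound _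
            · refine (abs_sub _ _).trans (add_le_add ?_ ?_) <;> split_ifs <;> simp
            · exact abs_I_le k η x
        _ = _ := by
            rw [sum_site_normal fun x => K * (|σ| * ((if x = 1 then 1 else 0) +
              (if x = N - 1 then 1 else 0))) * M.compNorm k, ← Finset.sum_mul, ← Finset.mul_sum,
              ← Finset.mul_sum, Finset.sum_add_distrib, Finset.sum_ite_eq', Finset.sum_ite_eq',
              if_pos (Finset.mem_Ico.2 ⟨le_rfl, by omega⟩),
              if_pos (Finset.mem_Ico.2 ⟨by omega, by omega⟩)]
            field_simp
            ring
    set G := (N : ℝ) ^ 2 * -(1 / (N : ℝ) ^ θ * (h 1 * M.V1left k g η + h (N - 1) * M.V1right k g η))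
    have h4 : (N : ℝ) ^ 2 / 2 * |Lp| ≤ K * M.compNorm k * (3 * (N * a)) := by
      calc _ ≤ (N : ℝ) ^ 2 / 2 * (K * M.compNorm k * (2 * (a / ((N : ℝ) - 2)))) := by
            gcongr
            exact hLpb.trans (by gcongr)
        _ = K * M.compNorm k * (N / ((N : ℝ) - 2) * (N * a)) := by ring
        _ ≤ _ := by
            gcongr
            rw [div_le_iff₀ hL]; linarith
    have e : M.gen θ (testObs k g h) η - G =
        (M.gen θ (testObs k g h) η - (G + (N : ℝ) ^ 2 / 2 * Lp)) + (N : ℝ) ^ 2 / 2 * Lp := by ring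
    rw [e]
    refine (abs_add_le _ _).trans ?_
    rw [abs_mul ((N : ℝ) ^ 2 / 2), abs_of_nonneg (by positivity : 0 ≤ (N : ℝ) ^ 2 / 2)]
    have h5 : K * M.compNorm k * (n + M.jumpMoment) *
      (N * ∑ x ∈ Finset.Ico 1 (N - 1), |h (x + 1) - h x| + ∑ x ∈ Finset.Ico 1 N, |h x|) ≤
      K * M.compNorm k * (n + M.jumpMoment) * (N * a + N * a) := by gcongr
    have h6 : 0 ≤ K * M.compNorm k * (N * a) := by positivity
    have h7 : 0 ≤ K * M.compNorm k * (n + M.jumpMoment) * (N * a) := by positivity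
    rw [poissonConst]
    nlinarith

/-- The profile equal to `N ^ (θ - 2)` at the left end cancels the prefactor `N ^ (2 - θ)` of the
reservoir term there. -/
theorem exists_poisson_V1left {K : ℝ} {g : Torus n → ℝ} (hg : SmoothBound K g) (k : Fin (n + 2))
    (θ : ℝ) (hN : 3 ≤ N) :
    ∃ F : M.Config N → ℝ, (∀ η, |F η| ≤ K * M.poissonConst k * (N : ℝ) ^ (θ - 1)) ∧
      ∀ η, |M.gen θ F η + M.V1left k g η| ≤ K * M.poissonConst k * (N : ℝ) ^ (θ - 1) := by
  have h3 : (3 : ℝ) ≤ N := by exact_mod_cast hN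
  have hL : 0 < (N : ℝ) - 2 := by linarith
  have hN0 : (0 : ℝ) < N := by linarith
  set a : ℝ := (N : ℝ) ^ (θ - 2) with ha
  have ha0 : 0 < a := Real.rpow_pos_of_pos hN0 _
  have e1 : (N : ℝ) * a = (N : ℝ) ^ (θ - 1) := by
    rw [ha, show θ - 1 = 1 + (θ - 2) by ring, Real.rpow_add hN0, Real.rpow_one]
  have e2 : (N : ℝ) ^ 2 * a = (N : ℝ) ^ θ := by
    rw [ha, ← Real.rpow_natCast, ← Real.rpow_add hN0]; congr 1; push_cast; ring
  -- the profile decreases linearly from `N ^ (θ - 2)` to `0`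
  set h : ℕ → ℝ := fun x => a * (1 - ((x : ℝ) - 1) / ((N : ℝ) - 2)) with hh
  have key := gen_testObs_affine (M := M) hg k θ hN (h := h) (b := a * (1 + 1 / ((N : ℝ) - 2)))
    (σ := -(a / ((N : ℝ) - 2))) (a := a) (fun x => by simp only [hh]; ring) (fun x hx => by
      have hx := Finset.mem_Ico.1 hx
      have hx1 : (1 : ℝ) ≤ x := by exact_mod_cast hx.1
      have hx2 : (x : ℝ) + 1 ≤ N := by exact_mod_cast hx.2
      have h4 : ((x : ℝ) - 1) / ((N : ℝ) - 2) ≤ 1 := by rw [div_le_one hL]; linarith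
      have h5 : 0 ≤ ((x : ℝ) - 1) / ((N : ℝ) - 2) := div_nonneg (by linarith) hL.le
      rw [abs_of_nonneg (mul_nonneg ha0.le (by linarith))]
      exact mul_le_of_le_one_right ha0.le (by linarith))
    (by rw [abs_neg, abs_of_nonneg (by positivity)])
  rw [← e1]
  refine ⟨testObs k g h, fun η => (key η).1, fun η => ?_⟩
  have h6 : h 1 = a := by simp [hh]
  have h7 : h (N - 1) = 0 := by
    simp only [hh]
    rw [Nat.cast_sub (by omega)]
    have : ((N : ℝ) - ((1 : ℕ) : ℝ) - 1) / ((N : ℝ) - 2) = 1 := by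
      rw [div_eq_one_iff_eq hL.ne']; push_cast; ring
    rw [this]; ring
  have h8 := (key η).2
  have hθ : (N : ℝ) ^ θ ≠ 0 := (Real.rpow_pos_of_pos hN0 _).ne'
  have e3 : (N : ℝ) ^ 2 * -(1 / (N : ℝ) ^ θ * (h 1 * M.V1left k g η + h (N - 1) * M.V1right k g η)) =
      -M.V1left k g η := by
    rw [h6, h7, zero_mul, add_zero]
    calc _ = -((N : ℝ) ^ 2 * a / (N : ℝ) ^ θ * M.V1left k g η) := by ring
      _ = _ := by rw [e2, div_self hθ, one_mul]
  rwa [e3, sub_neg_eq_add] at h8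

/-- Mirror image of the previous statement. -/
theorem exists_poisson_V1right {K : ℝ} {g : Torus n → ℝ} (hg : SmoothBound K g) (k : Fin (n + 2))
    (θ : ℝ) (hN : 3 ≤ N) :
    ∃ F : M.Config N → ℝ, (∀ η, |F η| ≤ K * M.poissonConst k * (N : ℝ) ^ (θ - 1)) ∧
      ∀ η, |M.gen θ F η + M.V1right k g η| ≤ K * M.poissonConst k * (N : ℝ) ^ (θ - 1) := by
  have h3 : (3 : ℝ) ≤ N := by exact_mod_cast hN
  have hL : 0 < (N : ℝ) - 2 := by linarith
  have hN0 : (0 : ℝ) < N := by linarith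
  set a : ℝ := (N : ℝ) ^ (θ - 2) with ha
  have ha0 : 0 < a := Real.rpow_pos_of_pos hN0 _
  have e1 : (N : ℝ) * a = (N : ℝ) ^ (θ - 1) := by
    rw [ha, show θ - 1 = 1 + (θ - 2) by ring, Real.rpow_add hN0, Real.rpow_one]
  have e2 : (N : ℝ) ^ 2 * a = (N : ℝ) ^ θ := by
    rw [ha, ← Real.rpow_natCast, ← Real.rpow_add hN0]; congr 1; push_cast; ring
  -- the profile increases linearly from `0` to `N ^ (θ - 2)`
  set h : ℕ → ℝ := fun x => a * (((x : ℝ) - 1) / ((N : ℝ) - 2)) with hh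
  have key := gen_testObs_affine (M := M) hg k θ hN (h := h) (b := -(a / ((N : ℝ) - 2)))
    (σ := a / ((N : ℝ) - 2)) (a := a) (fun x => by simp only [hh]; ring) (fun x hx => by
      have hx := Finset.mem_Ico.1 hx
      have hx1 : (1 : ℝ) ≤ x := by exact_mod_cast hx.1
      have hx2 : (x : ℝ) + 1 ≤ N := by exact_mod_cast hx.2
      have h4 : ((x : ℝ) - 1) / ((N : ℝ) - 2) ≤ 1 := by rw [div_le_one hL]; linarith
      have h5 : 0 ≤ ((x : ℝ) - 1) / ((N : ℝ) - 2) := div_nonneg (by linarith) hL.le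
      rw [abs_of_nonneg (mul_nonneg ha0.le h5)]
      exact mul_le_of_le_one_right ha0.le h4)
    (by rw [abs_of_nonneg (by positivity)])
  rw [← e1]
  refine ⟨testObs k g h, fun η => (key η).1, fun η => ?_⟩
  have h6 : h 1 = 0 := by simp [hh]
  have h7 : h (N - 1) = a := by
    simp only [hh]
    rw [Nat.cast_sub (by omega)]
    have : ((N : ℝ) - ((1 : ℕ) : ℝ) - 1) / ((N : ℝ) - 2) = 1 := by
      rw [div_eq_one_iff_eq hL.ne']; push_cast; ring
    rw [this]; ring
  have h8 := (key η).2
  have hθ : (N : ℝ) ^ θ ≠ 0 := (Real.rpow_pos_of_pos hN0 _).ne'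
  have e3 : (N : ℝ) ^ 2 * -(1 / (N : ℝ) ^ θ * (h 1 * M.V1left k g η + h (N - 1) * M.V1right k g η)) =
      -M.V1right k g η := by
    rw [h6, h7, zero_mul, zero_add]
    calc _ = -((N : ℝ) ^ 2 * a / (N : ℝ) ^ θ * M.V1right k g η) := by ring
      _ = _ := by rw [e2, div_self hθ, one_mul]
  rwa [e3, sub_neg_eq_add] at h8


theorem lap_const_mul_sum {ι : Type*} (s : Finset ι) (c : ℝ) (f : ι → ℕ → ℝ) (x : ℕ) :
    lap N (fun x => c * ∑ i ∈ s, f i x) x = c * ∑ i ∈ s, lap N (f i) x := by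
  simp only [lap, Finset.sum_add_distrib, mul_add, ← mul_sub, ← Finset.sum_sub_distrib]
  congr 1 <;> split_ifs <;> simp

theorem sum_leftSites (hN : 2 ≤ N) (f : Site n N → ℝ) :
    ∑ x ∈ leftSites n N, f x = ∑ u, f (⟨1, Finset.mem_Ico.2 ⟨le_rfl, hN⟩⟩, u) := by
  rw [leftSites, Finset.sum_filter, Fintype.sum_prod_type, Finset.sum_comm]
  refine Finset.sum_congr rfl fun u _ => ?_
  rw [Finset.sum_eq_single (⟨1, Finset.mem_Ico.2 ⟨le_rfl, hN⟩⟩ : ↥(Finset.Ico 1 N))]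
  · simp
  · intro z _ hz
    rw [if_neg fun h => hz (Subtype.ext h)]
  · simp

theorem sum_rightSites (hN : 2 ≤ N) (f : Site n N → ℝ) :
    ∑ x ∈ rightSites n N, f x =
      ∑ u, f (⟨N - 1, Finset.mem_Ico.2 ⟨by omega, by omega⟩⟩, u) := by
  rw [rightSites, Finset.sum_filter, Fintype.sum_prod_type, Finset.sum_comm]
  refine Finset.sum_congr rfl fun u _ => ?_
  rw [Finset.sum_eq_single (⟨N - 1, Finset.mem_Ico.2 ⟨by omega, by omega⟩⟩ : ↥(Finset.Ico 1 N))]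
  · have : N - 1 + 1 = N := by omega
    simp [this]
  · intro z _ hz
    rw [if_neg fun h => hz (Subtype.ext (Nat.eq_sub_of_add_eq h))]
  · simp

/-- Averages of Green functions replace the occupation at the boundary site `e` by its average over
a window `Y` of `m + 1` sites next to `e`; `e'` is the opposite end. -/
theorem exists_poisson_average {K : ℝ} {g : Torus n → ℝ} (hg : SmoothBound K g) (k : Fin (n + 2))
    (θ : ℝ) (hN : 3 ≤ N) (e e' : ↥(Finset.Ico 1 N)) (Y : Finset ↥(Finset.Ico 1 N)) {m : ℕ}
    (hm : 1 ≤ m) (hcard : Y.card = m + 1) (hpeak : ∀ y ∈ Y, greenPeak N y ≤ m)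
    (r : ↥(Finset.Ico 1 N) → ℝ) (hr : ∀ y ∈ Y, |r y| ≤ m / ((N : ℝ) - 2))
    (hlap : ∀ y ∈ Y, ∀ x : ↥(Finset.Ico 1 N), lap N (green N y) x =
      (if x = e then 1 else 0) - (if x = y then 1 else 0) +
        r y * ((if x = e' then 1 else 0) - (if x = e then 1 else 0))) :
    ∃ F : M.Config N → ℝ,
      (∀ η, |F η| ≤ K * M.poissonConst k * (1 / m + (m + 1) / N)) ∧
      ∀ η, |M.gen θ F η + 1 / (N : ℝ) ^ n * ∑ u, g (scaledT u) *
        (I k η (e, u) - 1 / m * ∑ y ∈ Y, I k η (y, u))| ≤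
          K * M.poissonConst k * (1 / m + (m + 1) / N) := by
  have h3 : (3 : ℝ) ≤ N := by exact_mod_cast hN
  have hL : 0 < (N : ℝ) - 2 := by linarith
  have hN0 : (0 : ℝ) < N := by linarith
  have hm0 : (0 : ℝ) < m := by exact_mod_cast hm
  have hK : 0 ≤ K := (norm_nonneg _).trans (hg.bound 0)
  have hS := M.compNorm_nonneg k
  have hJ := M.jumpMoment_nonneg
  set c : ℝ := 2 / (N : ℝ) ^ 2 * (1 / m) with hc
  have hc0 : 0 < c := by positivity
  -- to leading order, `N ^ 2 / 2` times the Laplacian of `h` is minus the sum of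
  -- `(δ_e - δ_y) / m` over `y ∈ Y`
  set h : ℕ → ℝ := fun x => -c * ∑ y ∈ Y, green N y x with hh
  have hcm : c * ((m + 1) * m) = 2 * (m + 1) / (N : ℝ) ^ 2 := by rw [hc]; field_simp
  have hA : ∑ x ∈ Finset.Ico 1 N, |h x| ≤ 2 * ((m + 1) / N) := by
    have : ∀ x ∈ Finset.Ico 1 N, |h x| ≤ 2 * (m + 1) / (N : ℝ) ^ 2 := fun x hx => by
      rw [← hcm, hh, abs_mul, abs_neg, abs_of_pos hc0]
      refine mul_le_mul_of_nonneg_left ?_ hc0.le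
      refine (Finset.abs_sum_le_sum_abs _ _).trans ?_
      refine (Finset.sum_le_card_nsmul _ _ (m : ℝ) fun y hy =>
        (abs_green_le hN hx y.2).trans (hpeak y hy)).trans ?_
      rw [hcard, nsmul_eq_mul]; push_cast; exact le_rfl
    refine (Finset.sum_le_card_nsmul _ _ _ this).trans ?_
    rw [Nat.card_Ico, nsmul_eq_mul]
    calc ((N - 1 : ℕ) : ℝ) * (2 * (m + 1) / (N : ℝ) ^ 2) ≤ N * (2 * (m + 1) / (N : ℝ) ^ 2) := by
          gcongr; exact_mod_cast Nat.sub_le _ _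
      _ = _ := by field_simp
  have hB : ∑ x ∈ Finset.Ico 1 (N - 1), |h (x + 1) - h x| ≤ 2 * (2 * (m + 1) / (N : ℝ) ^ 2) := by
    calc ∑ x ∈ Finset.Ico 1 (N - 1), |h (x + 1) - h x|
        ≤ ∑ x ∈ Finset.Ico 1 (N - 1), c * ∑ y ∈ Y, |green N y (x + 1) - green N y x| := by
          refine Finset.sum_le_sum fun x _ => ?_
          simp only [hh]
          rw [← mul_sub, ← Finset.sum_sub_distrib, abs_mul, abs_neg, abs_of_pos hc0]
          exact mul_le_mul_of_nonneg_left (Finset.abs_sum_le_sum_abs _ _) hc0.le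
      _ = c * ∑ y ∈ Y, 2 * greenPeak N y := by
          rw [← Finset.mul_sum, Finset.sum_comm]
          congr 1
          exact Finset.sum_congr rfl fun y _ => sum_abs_green_increment hN y.2
      _ ≤ c * ∑ y ∈ Y, 2 * (m : ℝ) := by
          gcongr with y hy; exact hpeak y hy
      _ = _ := by
          rw [← hcm, Finset.sum_const, hcard, nsmul_eq_mul]; push_cast; ring
  have hKS : 0 ≤ K * M.compNorm k := by positivity
  have hn : (0 : ℝ) ≤ n := by positivity
  have hw : (0 : ℝ) ≤ (m + 1) / N := by positivity
  refine ⟨testObs k g h, fun η => ?_, fun η => ?_⟩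
  · refine (abs_testObs_le hg h k η (by omega)).trans ?_
    have h1 : K * M.compNorm k * ∑ x ∈ Finset.Ico 1 N, |h x| ≤
      K * M.compNorm k * (2 * ((m + 1) / N)) := by gcongr
    refine h1.trans ?_
    rw [poissonConst, ← mul_assoc K, mul_assoc (K * M.compNorm k)]
    refine mul_le_mul_of_nonneg_left ?_ hKS
    have h2 : (0 : ℝ) ≤ 1 / m := by positivity
    have h4 : 0 ≤ (n + M.jumpMoment) * (1 / m + (m + 1) / N) := by positivity
    nlinarith
  · have hgen := gen_testObs_sub_le (M := M) hg h k θ (by omega) η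
    have hz1 : h 1 = 0 := by
      simp only [hh]
      rw [Finset.sum_eq_zero fun y _ => green_one (Finset.mem_Ico.1 y.2).1, mul_zero]
    have hz2 : h (N - 1) = 0 := by
      simp only [hh]
      rw [Finset.sum_eq_zero fun y _ => green_last hN y.2, mul_zero]
    rw [hz1, hz2, zero_mul, zero_mul, add_zero, mul_zero, neg_zero, mul_zero, zero_add] at hgen
    set V : ℝ := 1 / (N : ℝ) ^ n * ∑ u, g (scaledT u) *
        (I k η (e, u) - 1 / m * ∑ y ∈ Y, I k η (y, u)) with hV
    set Lp : ℝ := (N : ℝ) ^ 2 / 2 *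
      (1 / (N : ℝ) ^ n * ∑ x : Site n N, g (scaled x) * lap N h x.1 * I k η x) with hLp
    have hpt : ∀ u : Fin n → Fin N, ∑ x : ↥(Finset.Ico 1 N), lap N h x * I k η (x, u) =
        -c * ∑ y ∈ Y, (I k η (e, u) - I k η (y, u) + r y * (I k η (e', u) - I k η (e, u))) := by
      intro u
      have e1 : ∀ x : ↥(Finset.Ico 1 N), lap N h x * I k η (x, u) = -c * ∑ y ∈ Y,
          ((if x = e then 1 else 0) - (if x = y then 1 else 0) +
            r y * ((if x = e' then 1 else 0) - (if x = e then 1 else 0))) * I k η (x, u) := by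
        intro x
        rw [hh, lap_const_mul_sum, mul_assoc, Finset.sum_mul]
        congr 1
        exact Finset.sum_congr rfl fun y hy => by rw [hlap y hy x]
      rw [Finset.sum_congr rfl fun x _ => e1 x, ← Finset.mul_sum, Finset.sum_comm]
      congr 1
      refine Finset.sum_congr rfl fun y _ => ?_
      simp only [add_mul, sub_mul, mul_sub, mul_assoc, ite_mul, one_mul, zero_mul, mul_ite, mul_zero,
        Finset.sum_add_distrib, Finset.sum_sub_distrib, Finset.sum_ite_eq', Finset.mem_univ, if_true]
    -- the window has `m + 1` sites but the average divides by `m`: this leaves `-I_k / m`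
    have hLV : Lp + V = 1 / (N : ℝ) ^ n * ∑ u, g (scaledT u) * (1 / m * (-I k η (e, u) -
        ∑ y ∈ Y, r y * (I k η (e', u) - I k η (e, u)))) := by
      have e2 : Lp = 1 / (N : ℝ) ^ n * ∑ u, g (scaledT u) * (-(1 / m) *
          ∑ y ∈ Y, (I k η (e, u) - I k η (y, u) + r y * (I k η (e', u) - I k η (e, u)))) := by
        rw [hLp, Fintype.sum_prod_type, Finset.sum_comm, mul_left_comm, Finset.mul_sum]
        congr 1
        refine Finset.sum_congr rfl fun u _ => ?_
        have e3 : ∑ x : ↥(Finset.Ico 1 N), g (scaled (x, u)) * lap N h x * I k η (x, u) =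
            g (scaledT u) * ∑ x : ↥(Finset.Ico 1 N), lap N h x * I k η (x, u) := by
          rw [Finset.mul_sum]
          exact Finset.sum_congr rfl fun x _ => by rw [mul_assoc]; rfl
        rw [e3, hpt, hc]
        generalize ∑ y ∈ Y, (I k η (e, u) - I k η (y, u) +
          r y * (I k η (e', u) - I k η (e, u))) = S
        field_simp
      rw [e2, hV, ← mul_add, ← Finset.sum_add_distrib]
      congr 1
      refine Finset.sum_congr rfl fun u _ => ?_
      rw [← mul_add]
      congr 1
      rw [Finset.sum_add_distrib, Finset.sum_sub_distrib, Finset.sum_const, hcard, nsmul_eq_mul]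
      generalize ∑ y ∈ Y, r y * (I k η (e', u) - I k η (e, u)) = S
      push_cast
      field_simp
      ring
    have hLVb : |Lp + V| ≤ K * M.compNorm k * (1 / m + 6 * ((m + 1) / N)) := by
      have hu : ∀ u : Fin n → Fin N, |g (scaledT u) * (1 / m * (-I k η (e, u) -
          ∑ y ∈ Y, r y * (I k η (e', u) - I k η (e, u))))| ≤
          K * (1 / m * (M.compNorm k + (m + 1) * (m / ((N : ℝ) - 2) * (2 * M.compNorm k)))) := by
        intro u
        rw [abs_mul, abs_mul, abs_of_pos (by positivity : (0 : ℝ) < 1 / m)]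
        refine mul_le_mul (hg.bound _) (mul_le_mul_of_nonneg_left ?_ (by positivity))
          (by positivity) hK
        refine (abs_sub _ _).trans (add_le_add ?_ ?_)
        · rw [abs_neg]; exact abs_I_le _ _ _
        · refine (Finset.abs_sum_le_sum_abs _ _).trans ((Finset.sum_le_card_nsmul _ _
            (m / ((N : ℝ) - 2) * (2 * M.compNorm k)) fun y hy => ?_).trans ?_)
          · rw [abs_mul]
            refine mul_le_mul (hr y hy) ?_ (abs_nonneg _) (by positivity)
            refine (abs_sub _ _).trans ?_
            linarith [abs_I_le k η (e', u), abs_I_le k η (e, u)]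
          · rw [hcard, nsmul_eq_mul]; push_cast; exact le_rfl
      rw [hLV, abs_mul, abs_of_nonneg (by positivity : 0 ≤ 1 / (N : ℝ) ^ n)]
      calc _ ≤ 1 / (N : ℝ) ^ n * ∑ u : Fin n → Fin N, K * (1 / m * (M.compNorm k +
            (m + 1) * (m / ((N : ℝ) - 2) * (2 * M.compNorm k)))) := by
            refine mul_le_mul_of_nonneg_left ?_ (by positivity)
            exact (Finset.abs_sum_le_sum_abs _ _).trans (Finset.sum_le_sum fun u _ => hu u)
        _ = K * M.compNorm k * (1 / m + 2 * ((m + 1) / ((N : ℝ) - 2))) := by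
            simp only [Finset.sum_const, Finset.card_univ, Fintype.card_pi, Fintype.card_fin,
              Finset.prod_const, nsmul_eq_mul, Nat.cast_pow]
            field_simp
        _ ≤ _ := by
            refine mul_le_mul_of_nonneg_left ?_ hKS
            have : (m + 1 : ℝ) / ((N : ℝ) - 2) ≤ 3 * ((m + 1) / N) := by
              rw [div_le_iff₀ hL, mul_assoc, div_mul_eq_mul_div, ← mul_div_assoc, le_div_iff₀ hN0]
              nlinarith
            linarith
    have e5 : M.gen θ (testObs k g h) η + V = (M.gen θ (testObs k g h) η - Lp) + (Lp + V) := by ring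
    rw [e5]
    refine (abs_add_le _ _).trans ?_
    have h6 : |M.gen θ (testObs k g h) η - Lp| ≤ K * M.compNorm k * (n + M.jumpMoment) *
        (N * (2 * (2 * (m + 1) / (N : ℝ) ^ 2)) + 2 * ((m + 1) / N)) := hgen.trans (by gcongr)
    have h7 : (N : ℝ) * (2 * (2 * (m + 1) / (N : ℝ) ^ 2)) + 2 * ((m + 1) / N) =
        6 * ((m + 1) / N) := by field_simp; ring
    rw [h7] at h6
    have h8 : K * M.compNorm k * (n + M.jumpMoment) * (6 * ((m + 1) / N)) +
        K * M.compNorm k * (1 / m + 6 * ((m + 1) / N)) ≤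
        K * M.poissonConst k * (1 / m + (m + 1) / N) := by
      rw [poissonConst, ← mul_assoc K, mul_assoc (K * M.compNorm k),
        mul_assoc (K * M.compNorm k) (13 + _), ← mul_add]
      refine mul_le_mul_of_nonneg_left ?_ hKS
      have h2 : (0 : ℝ) ≤ 1 / m := by positivity
      have h4 : 0 ≤ (n + M.jumpMoment) * (1 / m) := by positivity
      have h5 : 0 ≤ (n + M.jumpMoment) * ((m + 1) / N) := by positivity
      nlinarith
    linarith

theorem card_leftWindow {m : ℕ} (hmN : m + 1 < N) :
    ((Finset.univ : Finset ↥(Finset.Ico 1 N)).filter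
      fun y : ↥(Finset.Ico 1 N) => (y.1 : ℕ) ≤ m + 1).card = m + 1 := by
  have : ((Finset.univ : Finset ↥(Finset.Ico 1 N)).filter
      fun y : ↥(Finset.Ico 1 N) => (y.1 : ℕ) ≤ m + 1).map (Function.Embedding.subtype _) =
      Finset.Ico 1 (m + 2) := by
    ext x
    simp only [Finset.mem_map, Finset.mem_filter, Finset.mem_univ, true_and,
      Function.Embedding.subtype_apply, Finset.mem_Ico]
    constructor
    · rintro ⟨y, hy, rfl⟩
      have := Finset.mem_Ico.1 y.2
      omega
    · intro hx
      exact ⟨⟨x, Finset.mem_Ico.2 ⟨hx.1, by omega⟩⟩, by simp only; omega, rfl⟩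
  rw [← Finset.card_map (Function.Embedding.subtype _), this, Nat.card_Ico]; omega

theorem card_rightWindow {m : ℕ} (hmN : m + 1 < N) :
    ((Finset.univ : Finset ↥(Finset.Ico 1 N)).filter
      fun y : ↥(Finset.Ico 1 N) => N ≤ (y.1 : ℕ) + 1 + m).card = m + 1 := by
  have : ((Finset.univ : Finset ↥(Finset.Ico 1 N)).filter
      fun y : ↥(Finset.Ico 1 N) => N ≤ (y.1 : ℕ) + 1 + m).map (Function.Embedding.subtype _) =
      Finset.Ico (N - 1 - m) N := by
    ext x
    simp only [Finset.mem_map, Finset.mem_filter, Finset.mem_univ, true_and,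
      Function.Embedding.subtype_apply, Finset.mem_Ico]
    constructor
    · rintro ⟨y, hy, rfl⟩
      have := Finset.mem_Ico.1 y.2
      omega
    · intro hx
      exact ⟨⟨x, Finset.mem_Ico.2 ⟨by omega, by omega⟩⟩, by simp only; omega, rfl⟩
  rw [← Finset.card_map (Function.Embedding.subtype _), this, Nat.card_Ico]; omega

/-- The window is next to the left end, and the slope of each Green function at the far end `N - 1`
is `(y - 1) / (N - 2) = O(ε)`. -/
theorem exists_poisson_V2left {K : ℝ} {g : Torus n → ℝ} (hg : SmoothBound K g) (k : Fin (n + 2))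
    (θ ε : ℝ) (hN : 3 ≤ N) (hm : 1 ≤ ⌊ε * N⌋₊) (hmN : ⌊ε * N⌋₊ + 1 < N) :
    ∃ F : M.Config N → ℝ,
      (∀ η, |F η| ≤ K * M.poissonConst k * (1 / (⌊ε * N⌋₊ : ℝ) + ((⌊ε * N⌋₊ : ℝ) + 1) / N)) ∧
      ∀ η, |M.gen θ F η + M.V2left ε k g η| ≤
        K * M.poissonConst k * (1 / (⌊ε * N⌋₊ : ℝ) + ((⌊ε * N⌋₊ : ℝ) + 1) / N) := by
  have h3 : (3 : ℝ) ≤ N := by exact_mod_cast hN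
  have hL : 0 < (N : ℝ) - 2 := by linarith
  set m := ⌊ε * N⌋₊ with hmdef
  set Y := (Finset.univ : Finset ↥(Finset.Ico 1 N)).filter
    (fun y : ↥(Finset.Ico 1 N) => (y.1 : ℕ) ≤ m + 1) with hY
  have hcard : Y.card = m + 1 := card_leftWindow hmN
  have hYm : ∀ y ∈ Y, ((y : ℕ) : ℝ) - 1 ≤ m := fun y hy => by
    have : ((y : ℕ) : ℝ) ≤ m + 1 := by exact_mod_cast (Finset.mem_filter.1 hy).2
    linarith
  obtain ⟨F, hF1, hF2⟩ := exists_poisson_average (M := M) hg k θ hN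
    ⟨1, Finset.mem_Ico.2 ⟨le_rfl, by omega⟩⟩ ⟨N - 1, Finset.mem_Ico.2 ⟨by omega, by omega⟩⟩ Y hm hcard
    (fun y hy => (greenPeak_le_left hN y.2).trans (hYm y hy))
    (fun y => (((y : ℕ) : ℝ) - 1) / ((N : ℝ) - 2)) (fun y hy => by
      have : (1 : ℝ) ≤ (y : ℕ) := by exact_mod_cast (Finset.mem_Ico.1 y.2).1
      rw [abs_of_nonneg (div_nonneg (by linarith) hL.le)]
      gcongr
      exact hYm y hy)
    (fun y _ x => by
      rw [lap_green hN x.2 y.2]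
      simp only [Subtype.ext_iff])
  refine ⟨F, hF1, fun η => ?_⟩
  rw [V2left, sum_leftSites (by omega)]
  exact hF2 η

/-- Mirror image of the previous statement, with the same Green functions. -/
theorem exists_poisson_V2right {K : ℝ} {g : Torus n → ℝ} (hg : SmoothBound K g) (k : Fin (n + 2))
    (θ ε : ℝ) (hN : 3 ≤ N) (hm : 1 ≤ ⌊ε * N⌋₊) (hmN : ⌊ε * N⌋₊ + 1 < N) :
    ∃ F : M.Config N → ℝ,
      (∀ η, |F η| ≤ K * M.poissonConst k * (1 / (⌊ε * N⌋₊ : ℝ) + ((⌊ε * N⌋₊ : ℝ) + 1) / N)) ∧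
      ∀ η, |M.gen θ F η + M.V2right ε k g η| ≤
        K * M.poissonConst k * (1 / (⌊ε * N⌋₊ : ℝ) + ((⌊ε * N⌋₊ : ℝ) + 1) / N) := by
  have h3 : (3 : ℝ) ≤ N := by exact_mod_cast hN
  have hL : 0 < (N : ℝ) - 2 := by linarith
  set m := ⌊ε * N⌋₊ with hmdef
  set Y := (Finset.univ : Finset ↥(Finset.Ico 1 N)).filter
    (fun y : ↥(Finset.Ico 1 N) => N ≤ (y.1 : ℕ) + 1 + m) with hY
  have hcard : Y.card = m + 1 := card_rightWindow hmN
  have hYm : ∀ y ∈ Y, (N : ℝ) - 1 - (y : ℕ) ≤ m := fun y hy => by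
    have : (N : ℝ) ≤ (y : ℕ) + 1 + m := by exact_mod_cast (Finset.mem_filter.1 hy).2
    linarith
  obtain ⟨F, hF1, hF2⟩ := exists_poisson_average (M := M) hg k θ hN
    ⟨N - 1, Finset.mem_Ico.2 ⟨by omega, by omega⟩⟩ ⟨1, Finset.mem_Ico.2 ⟨le_rfl, by omega⟩⟩ Y hm hcard
    (fun y hy => (greenPeak_le_right hN y.2).trans (hYm y hy))
    (fun y => ((N : ℝ) - 1 - (y : ℕ)) / ((N : ℝ) - 2)) (fun y hy => by
      have : ((y : ℕ) : ℝ) + 1 ≤ N := by exact_mod_cast (Finset.mem_Ico.1 y.2).2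
      rw [abs_of_nonneg (div_nonneg (by linarith) hL.le)]
      gcongr
      exact hYm y hy)
    (fun y _ x => by
      rw [lap_green hN x.2 y.2]
      simp only [Subtype.ext_iff]
      field_simp
      ring)
  refine ⟨F, hF1, fun η => ?_⟩
  rw [V2right, sum_rightSites (by omega)]
  exact hF2 η

end Model

/-! ### Continuous test functions -/

/-- A continuous function of time and space is uniformly close to one that is piecewise constant in
time and smooth in space. -/
theorem exists_piecewise_smoothBound_approx {n : ℕ} {G : ℝ → Torus n → ℝ} {t : ℝ} (ht : 0 ≤ t)
    (hG : ContinuousOn (Function.uncurry G) (Set.Icc 0 t ×ˢ Set.univ)) {ε : ℝ} (hε : 0 < ε) :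
    ∃ m : ℕ, 0 < m ∧ ∃ (K : ℝ) (g : ℕ → Torus n → ℝ), 0 ≤ K ∧ ∀ j < m, SmoothBound K (g j) ∧
      ∀ s ∈ Set.Icc (j * (t / m)) ((j + 1 : ℕ) * (t / m)), ∀ u, |G s u - g j u| ≤ ε := by
  have hcomp : IsCompact (Set.Icc (0 : ℝ) t ×ˢ (Set.univ : Set (Torus n))) :=
    isCompact_Icc.prod isCompact_univ
  obtain ⟨δ, hδ, hunif⟩ := Metric.uniformContinuousOn_iff.1
    (hcomp.uniformContinuousOn_of_continuous hG) (ε / 2) (by positivity)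
  set m : ℕ := ⌊t / δ⌋₊ + 1 with hm
  have hm0 : (0 : ℝ) < m := by positivity
  have htm : t / m < δ := by
    rw [div_lt_iff₀ hm0, mul_comm, ← div_lt_iff₀ hδ, hm]
    exact_mod_cast Nat.lt_floor_add_one _
  have htm0 : 0 ≤ t / m := by positivity
  have hmt : (m : ℝ) * (t / m) = t := by field_simp
  have hmem : ∀ j < m, ∀ s ∈ Set.Icc (j * (t / m)) ((j + 1 : ℕ) * (t / m)), s ∈ Set.Icc 0 t := by
    intro j hj s hs
    refine ⟨le_trans (by positivity) hs.1, hs.2.trans ?_⟩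
    have : ((j + 1 : ℕ) : ℝ) ≤ m := by exact_mod_cast hj
    calc ((j + 1 : ℕ) : ℝ) * (t / m) ≤ m * (t / m) := by gcongr
      _ = t := hmt
  have hleft : ∀ j : ℕ, j * (t / m) ∈ Set.Icc (j * (t / m)) ((j + 1 : ℕ) * (t / m)) := fun j =>
    ⟨le_rfl, by push_cast; linarith⟩
  have hex : ∀ j : ℕ, ∃ (K : ℝ) (f : Torus n → ℝ), j < m →
      SmoothBound K f ∧ ∀ u, |G (j * (t / m)) u - f u| ≤ ε / 2 := by
    intro j
    by_cases hj : j < m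
    · have hc : Continuous (G (j * (t / m))) := by
        rw [← continuousOn_univ]
        exact hG.comp (f := fun u => ((j : ℝ) * (t / m), u)) (by fun_prop)
          fun u _ => ⟨hmem j hj _ (hleft j), trivial⟩
      obtain ⟨K, f, h1, h2⟩ := exists_smoothBound_approx hc (half_pos hε)
      exact ⟨K, f, fun _ => ⟨h1, h2⟩⟩
    · exact ⟨0, 0, fun h => absurd h hj⟩
  choose K f hf using hex
  -- the sum of the constants of the finitely many pieces serves all of them
  refine ⟨m, by positivity, ∑ j ∈ Finset.range m, |K j|, f,
    Finset.sum_nonneg fun _ _ => abs_nonneg _, fun j hj => ⟨(hf j hj).1.mono ?_, fun s hs u => ?_⟩⟩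
  · exact (le_abs_self _).trans (Finset.single_le_sum (f := fun j => |K j|)
      (fun _ _ => abs_nonneg _) (Finset.mem_range.2 hj))
  · have h1 := hunif (s, u) ⟨hmem j hj s hs, trivial⟩ (j * (t / m), u)
      ⟨hmem j hj _ (hleft j), trivial⟩ (by
        rw [Prod.dist_eq, dist_self, max_eq_left dist_nonneg, Real.dist_eq,
          abs_of_nonneg (sub_nonneg.2 hs.1)]
        have := hs.2
        push_cast at this
        linarith)
    rw [Real.dist_eq] at h1
    simp only [Function.uncurry] at h1
    calc |G s u - f j u| = |(G s u - G (j * (t / m)) u) + (G (j * (t / m)) u - f j u)| := by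
          congr 1; ring
      _ ≤ ε / 2 + ε / 2 := (abs_add_le _ _).trans (add_le_add h1.le ((hf j hj).2 u))
      _ = ε := by ring

namespace Model
variable {n : ℕ} {M : Model n} {N : ℕ}

/-- The spatial average over `s` of a local function `b`, weighted with a function on the torus. -/
def averageObs (s : Finset (Site n N)) (b : M.Config N → Site n N → ℝ) (g : Torus n → ℝ)
    (η : M.Config N) : ℝ :=
  1 / (N : ℝ) ^ n * ∑ x ∈ s, g (scaled x) * b η x

theorem abs_averageObs_le {s : Finset (Site n N)} {b : M.Config N → Site n N → ℝ} {C : ℝ}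
    (hs : s.card ≤ N ^ n) (hb : ∀ η, ∀ x ∈ s, |b η x| ≤ C) (hC : 0 ≤ C) {K : ℝ} (hK : 0 ≤ K)
    {g : Torus n → ℝ} (hg : ∀ u, |g u| ≤ K) (η : M.Config N) : |averageObs s b g η| ≤ C * K := by
  have hcard : 1 / (N : ℝ) ^ n * s.card ≤ 1 := by
    rw [one_div_mul_eq_div]
    exact div_le_one_of_le₀ (by exact_mod_cast hs) (by positivity)
  rw [averageObs, abs_mul, abs_of_nonneg (by positivity : 0 ≤ 1 / (N : ℝ) ^ n)]
  calc _ ≤ 1 / (N : ℝ) ^ n * (s.card * (C * K)) := by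
        refine mul_le_mul_of_nonneg_left ?_ (by positivity)
        refine (Finset.abs_sum_le_sum_abs _ _).trans ?_
        rw [← nsmul_eq_mul]
        refine Finset.sum_le_card_nsmul _ _ _ fun x hx => ?_
        rw [abs_mul, mul_comm]
        exact mul_le_mul (hb η x hx) (hg _) (abs_nonneg _) hC
    _ = 1 / (N : ℝ) ^ n * s.card * (C * K) := by ring
    _ ≤ _ := mul_le_of_le_one_left (by positivity) hcard

theorem averageObs_sub (s : Finset (Site n N)) (b : M.Config N → Site n N → ℝ) (f g : Torus n → ℝ)
    (η : M.Config N) :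
    averageObs s b f η - averageObs s b g η = averageObs s b (fun u => f u - g u) η := by
  simp only [averageObs, sub_mul, Finset.sum_sub_distrib, mul_sub]

/-- For continuous test functions, the time integrals of spatial averages are small in mean as soon
as the Poisson equation is approximately solvable for smooth test functions. -/
theorem exists_threshold {θ t : ℝ} (ht : 0 ≤ t)
    {μ : ∀ N : ℕ, Measure (M.Config N)} {Ω : ℕ → Type*} [∀ N, MeasurableSpace (Ω N)]
    {ℙ : ∀ N, Measure (Ω N)} (hℙ : ∀ N, IsProbabilityMeasure (ℙ N))
    {η : ∀ N : ℕ, ℝ≥0 → Ω N → M.Config N} (hη : ∀ N, M.IsMarkovDynamics N θ (μ N) (ℙ N) (η N))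
    {G : ℝ → Torus n → ℝ}
    (hG : ContinuousOn (Function.uncurry G) (Set.Icc 0 t ×ˢ Set.univ)) {C : ℝ} (hC : 0 ≤ C)
    {κ : ℝ} (hκ : 0 < κ) :
    ∃ δ > 0, ∃ K ≥ 0, ∀ (N : ℕ) (s : Finset (Site n N)) (b : M.Config N → Site n N → ℝ),
      s.card ≤ N ^ n → (∀ η, ∀ x ∈ s, |b η x| ≤ C) →
      (∀ g : Torus n → ℝ, SmoothBound K g → ∃ F : M.Config N → ℝ, (∀ η, |F η| ≤ δ) ∧
        ∀ η, |M.gen θ F η + averageObs s b g η| ≤ δ) →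
      ∫⁻ ω, ‖∫ r in (0 : ℝ)..t, averageObs s b (G r) (η N r.toNNReal ω)‖ₑ ∂(ℙ N) ≤
        ENNReal.ofReal κ := by
  -- half of `κ` pays for the approximation of `G`, the other half for the `m` pieces
  set ε : ℝ := κ / (2 * ((C + 1) * (t + 1))) with hε
  have hε0 : 0 < ε := by positivity
  have hεC : C * ε * t ≤ κ / 2 := by
    have h1 : C * t ≤ (C + 1) * (t + 1) := by nlinarith
    calc C * ε * t = C * t * ε := by ring
      _ ≤ (C + 1) * (t + 1) * ε := by gcongr
      _ = κ / 2 := by rw [hε]; field_simp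
  obtain ⟨m, hm, K, g, hK, hg⟩ := exists_piecewise_smoothBound_approx ht hG hε0
  have hm0 : (0 : ℝ) < m := by exact_mod_cast hm
  have htm0 : 0 ≤ t / m := by positivity
  have hmt : (m : ℝ) * (t / m) = t := by field_simp
  -- on one piece the second moment is at most `D * δ`
  set D : ℝ := 2 * ((t / m) * (C * K * (2 + t / m))) with hD
  have hD0 : 0 ≤ D := by positivity
  refine ⟨(κ / (2 * m)) ^ 2 / (D + 1), by positivity, K, hK, fun N s b hs hb hP => ?_⟩
  set δ : ℝ := (κ / (2 * m)) ^ 2 / (D + 1) with hδ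
  have hδD : D * δ ≤ (κ / (2 * m)) ^ 2 := by
    rw [hδ, ← mul_div_assoc, div_le_iff₀ (by positivity)]
    nlinarith [sq_nonneg (κ / (2 * m))]
  have hP1 := hℙ N
  set a : ℕ → ℝ := fun j => j * (t / m) with ha
  have hamono : ∀ j, a j ≤ a (j + 1) := fun j => by simp only [ha]; push_cast; linarith
  have ha0 : ∀ j, 0 ≤ a j := fun j => by positivity
  have hadiff : ∀ j, a (j + 1) - a j = t / m := fun j => by simp only [ha]; push_cast; ring
  have hat : ∀ j < m, a (j + 1) ≤ t := fun j hj => by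
    have : ((j + 1 : ℕ) : ℝ) ≤ m := by exact_mod_cast hj
    calc ((j + 1 : ℕ) : ℝ) * (t / m) ≤ m * (t / m) := by gcongr
      _ = t := hmt
  let Z : ℕ → Ω N → ℝ := fun j ω => ∫ r in a j..a (j + 1), averageObs s b (g j) (η N r.toNNReal ω)
  have hZ : ∀ j < m, ∫⁻ ω, ‖Z j ω‖ₑ ∂(ℙ N) ≤ ENNReal.ofReal (κ / (2 * m)) := by
    intro j hj
    obtain ⟨F, hF1, hF2⟩ := hP (g j) (hg j hj).1
    refine (hη N).lintegral_enorm_le (C := C * K) (δ := δ)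
      (abs_averageObs_le hs hb hC hK (hg j hj).1.bound) hF1 hF2 (ha0 j) (hamono j)
      (by positivity) ?_
    rw [hadiff]
    calc _ = D * δ := by rw [hD]; ring
      _ ≤ _ := hδD
  have hint : ∀ ω, IntegrableOn (fun r => averageObs s b (G r) (η N r.toNNReal ω)) (Set.Icc 0 t) := by
    intro ω
    refine Integrable.const_mul (integrable_finsetSum _ fun x hx => ?_) _
    refine IntegrableOn.continuousOn_mul (K := Set.Icc 0 t) ?_ ?_ isCompact_Icc
    · exact hG.comp (f := fun r => (r, scaled x)) (by fun_prop) fun r hr => ⟨hr, trivial⟩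
    · refine Integrable.of_bound (C := C) ?_ (Eventually.of_forall fun r => hb _ x hx)
      exact (((hη N).measurable_uncurry fun ξ => b ξ x).comp
        measurable_prodMk_right).aestronglyMeasurable
  have hint' : ∀ ω j, IntervalIntegrable (fun r => averageObs s b (g j) (η N r.toNNReal ω))
      volume (a j) (a (j + 1)) := by
    intro ω j
    rw [intervalIntegrable_iff_integrableOn_Ioc_of_le (hamono j)]
    obtain ⟨B, hB⟩ := (Set.finite_range fun ξ : M.Config N => ‖averageObs s b (g j) ξ‖).bddAbove
    exact Integrable.of_bound (((hη N).measurable_uncurry (averageObs s b (g j))).comp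
      measurable_prodMk_right).aestronglyMeasurable B (Eventually.of_forall fun r => hB ⟨_, rfl⟩)
  have hpt : ∀ ω, |∫ r in (0 : ℝ)..t, averageObs s b (G r) (η N r.toNNReal ω)| ≤
      ∑ j ∈ Finset.range m, |Z j ω| + κ / 2 := by
    intro ω
    have hii : ∀ j < m, IntervalIntegrable (fun r => averageObs s b (G r) (η N r.toNNReal ω))
        volume (a j) (a (j + 1)) := fun j hj =>
      ((hint ω).mono_set (by
        rw [Set.uIcc_of_le (hamono j)]
        exact Set.Icc_subset_Icc (ha0 j) (hat j hj))).intervalIntegrable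
    have h0 : a 0 = 0 := by simp [ha]
    have hm' : a m = t := hmt
    have hsum := intervalIntegral.sum_integral_adjacent_intervals hii
    rw [h0, hm'] at hsum
    rw [← hsum]
    calc _ ≤ ∑ j ∈ Finset.range m, (|Z j ω| + C * ε * (t / m)) := by
          refine (Finset.abs_sum_le_sum_abs _ _).trans (Finset.sum_le_sum fun j hj => ?_)
          have hj := Finset.mem_range.1 hj
          have e1 : ∫ r in a j..a (j + 1), averageObs s b (G r) (η N r.toNNReal ω) = Z j ω +
              ∫ r in a j..a (j + 1), (averageObs s b (G r) (η N r.toNNReal ω) -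
                averageObs s b (g j) (η N r.toNNReal ω)) := by
            rw [intervalIntegral.integral_sub (hii j hj) (hint' ω j)]
            simp only [Z]; ring
          rw [e1]
          refine (abs_add_le _ _).trans (add_le_add le_rfl ?_)
          have h2 := intervalIntegral.norm_integral_le_of_norm_le_const (a := a j) (b := a (j + 1))
            (C := C * ε) (f := fun r => averageObs s b (G r) (η N r.toNNReal ω) -
                averageObs s b (g j) (η N r.toNNReal ω)) (fun r hr => by
              rw [Set.uIoc_of_le (hamono j)] at hr
              rw [averageObs_sub]
              exact abs_averageObs_le hs hb hC hε0.le
                (fun u => (hg j hj).2 r ⟨hr.1.le, hr.2⟩ u) _)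
          rwa [hadiff, abs_of_nonneg htm0] at h2
      _ = ∑ j ∈ Finset.range m, |Z j ω| + C * ε * t := by
          rw [Finset.sum_add_distrib, Finset.sum_const, Finset.card_range, nsmul_eq_mul,
            mul_left_comm, hmt]
      _ ≤ _ := by gcongr
  calc ∫⁻ ω, ‖∫ r in (0 : ℝ)..t, averageObs s b (G r) (η N r.toNNReal ω)‖ₑ ∂(ℙ N)
      ≤ ∫⁻ ω, (∑ j ∈ Finset.range m, ‖Z j ω‖ₑ + ENNReal.ofReal (κ / 2)) ∂(ℙ N) := by
        refine lintegral_mono fun ω => ?_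
        simp only [Real.enorm_eq_ofReal_abs]
        rw [← ENNReal.ofReal_sum_of_nonneg fun _ _ => abs_nonneg _,
          ← ENNReal.ofReal_add (Finset.sum_nonneg fun _ _ => abs_nonneg _) (by positivity)]
        exact ENNReal.ofReal_le_ofReal (hpt ω)
    _ = ∑ j ∈ Finset.range m, ∫⁻ ω, ‖Z j ω‖ₑ ∂(ℙ N) + ENNReal.ofReal (κ / 2) := by
        rw [lintegral_add_right _ measurable_const, lintegral_finsetSum]
        · simp
        · intro j _
          exact ((hη N).stronglyMeasurable_integral _ (hamono j)).enorm
    _ ≤ ∑ j ∈ Finset.range m, ENNReal.ofReal (κ / (2 * m)) + ENNReal.ofReal (κ / 2) := by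
        gcongr with j hj
        exact hZ j (Finset.mem_range.1 hj)
    _ = ENNReal.ofReal κ := by
        rw [← ENNReal.ofReal_sum_of_nonneg fun _ _ => by positivity, ← ENNReal.ofReal_add
          (Finset.sum_nonneg fun _ _ => by positivity) (by positivity), Finset.sum_const,
          Finset.card_range, nsmul_eq_mul]
        congr 1
        field_simp
        ring

/-! ### The boundary averages -/

theorem card_leftSites (hN : 2 ≤ N) : (leftSites n N).card = N ^ n := by
  have h := sum_leftSites (n := n) hN fun _ => (1 : ℝ)
  simp only [Finset.sum_const, Finset.card_univ, Fintype.card_pi, Fintype.card_fin,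
    Finset.prod_const, nsmul_eq_mul, mul_one] at h
  exact_mod_cast h

theorem card_rightSites (hN : 2 ≤ N) : (rightSites n N).card = N ^ n := by
  have h := sum_rightSites (n := n) hN fun _ => (1 : ℝ)
  simp only [Finset.sum_const, Finset.card_univ, Fintype.card_pi, Fintype.card_fin,
    Finset.prod_const, nsmul_eq_mul, mul_one] at h
  exact_mod_cast h

theorem abs_I_sub_density_le (k : Fin (n + 2)) (η : M.Config N) (x : Site n N) {ρ : M.vel → ℝ}
    (hρ : ∀ v, ρ v ∈ Set.Ioo (0 : ℝ) 1) :
    |I k η x - ∑ v, comp v k * ρ v| ≤ 3 * M.compNorm k := by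
  have h1 : |∑ v, comp v k * ρ v| ≤ M.compNorm k := by
    refine (Finset.abs_sum_le_sum_abs _ _).trans (Finset.sum_le_sum fun v _ => ?_)
    rw [abs_mul, abs_of_pos (hρ v).1]
    exact mul_le_of_le_one_right (abs_nonneg _) (hρ v).2.le
  refine (abs_sub _ _).trans ?_
  linarith [abs_I_le k η x, M.compNorm_nonneg k]

theorem abs_I_sub_average_le (k : Fin (n + 2)) (η : M.Config N) (x : Site n N)
    {Y : Finset ↥(Finset.Ico 1 N)} {m : ℕ} (hm : 1 ≤ m) (hY : Y.card = m + 1) :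
    |I k η x - 1 / (m : ℝ) * ∑ y ∈ Y, I k η (y, x.2)| ≤ 3 * M.compNorm k := by
  have hm0 : (1 : ℝ) ≤ m := by exact_mod_cast hm
  have h1 : |∑ y ∈ Y, I k η (y, x.2)| ≤ 2 * m * M.compNorm k := by
    refine (Finset.abs_sum_le_sum_abs _ _).trans
      ((Finset.sum_le_card_nsmul _ _ _ fun y _ => abs_I_le k η _).trans ?_)
    rw [hY, nsmul_eq_mul]
    push_cast
    have := M.compNorm_nonneg k
    gcongr
    linarith
  refine (abs_sub _ _).trans ?_
  have h2 : |1 / (m : ℝ) * ∑ y ∈ Y, I k η (y, x.2)| ≤ 2 * M.compNorm k := by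
    rw [abs_mul, abs_of_pos (by positivity)]
    calc _ ≤ 1 / (m : ℝ) * (2 * m * M.compNorm k) := by gcongr
      _ = _ := by field_simp
  linarith [abs_I_le k η x]

theorem limsup_eq_zero_of_eventually_le {ι : Type*} {l : Filter ι} {f : ι → ℝ≥0∞}
    (h : ∀ κ : ℝ, 0 < κ → ∀ᶠ i in l, f i ≤ ENNReal.ofReal κ) : limsup f l = 0 := by
  refine le_antisymm (ENNReal.le_of_forall_pos_le_add fun κ hκ _ => ?_) bot_le
  rw [zero_add, ← ENNReal.ofReal_coe_nnreal]
  exact limsup_le_of_le (by isBoundedDefault) (h κ hκ)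

/-- The mesoscopic scale `⌊εN⌋` for small `ε` and large `N`. -/
theorem eventually_window {ε : ℝ} (hε : 0 < ε) (hε2 : ε ≤ 1 / 2) :
    ∀ᶠ N : ℕ in atTop, 3 ≤ N ∧ 1 ≤ ⌊ε * N⌋₊ ∧ ⌊ε * N⌋₊ + 1 < N ∧
      1 / (⌊ε * N⌋₊ : ℝ) + ((⌊ε * N⌋₊ : ℝ) + 1) / N ≤ 3 * ε := by
  have hfl : Tendsto (fun N : ℕ => ⌊ε * (N : ℝ)⌋₊) atTop atTop :=
    tendsto_nat_floor_atTop.comp (tendsto_natCast_atTop_atTop.const_mul_atTop hε)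
  have h1 : ∀ᶠ N : ℕ in atTop, 1 / (N : ℝ) ≤ ε :=
    (tendsto_one_div_atTop_nhds_zero_nat.eventually_lt_const hε).mono fun _ h => h.le
  filter_upwards [eventually_ge_atTop 3, hfl.eventually (eventually_ge_atTop 1), h1,
    hfl.eventually h1] with N hN hm h1N h1m
  have hN0 : (3 : ℝ) ≤ N := by exact_mod_cast hN
  have hle : (⌊ε * (N : ℝ)⌋₊ : ℝ) ≤ ε * N := Nat.floor_le (by positivity)
  refine ⟨hN, hm, ?_, ?_⟩
  · have : (⌊ε * (N : ℝ)⌋₊ : ℝ) + 1 < N := by nlinarith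
    exact_mod_cast this
  · have h2 : ((⌊ε * (N : ℝ)⌋₊ : ℝ) + 1) / N ≤ ε + 1 / N := by
      rw [add_div]
      gcongr
      rwa [div_le_iff₀ (by linarith)]
    linarith

end Model
end LatticeGas

end

open LatticeGas LatticeGas.Model in
theorem mainTheorem4 {n : ℕ} (M : LatticeGas.Model n) (θ : ℝ) (hθ : 0 ≤ θ) (T : ℝ)
    (μ : ∀ N : ℕ, Measure (M.Config N)) (hμ : ∀ N, IsProbabilityMeasure (μ N))
    {Ω : ℕ → Type*} [∀ N, MeasurableSpace (Ω N)] (ℙ : ∀ N, Measure (Ω N))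
    (hℙ : ∀ N, IsProbabilityMeasure (ℙ N))
    (η : ∀ N : ℕ, ℝ≥0 → Ω N → M.Config N) (hη : ∀ N, M.IsMarkovDynamics N θ (μ N) (ℙ N) (η N))
    (G : ℝ → LatticeGas.Torus n → Fin (n + 2) → ℝ)
    (hG : ContinuousOn (Function.uncurry G) (Set.Icc 0 T ×ˢ Set.univ))
    (t : ℝ) (ht : t ∈ Set.Icc 0 T) (k : Fin (n + 2)) :
    (θ < 1 →
      limsup (fun N : ℕ => ∫⁻ ω, ‖∫ s in (0 : ℝ)..t,
        M.V1left k (fun u => G s u k) (η N s.toNNReal ω)‖ₑ ∂(ℙ N)) atTop = 0 ∧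
      limsup (fun N : ℕ => ∫⁻ ω, ‖∫ s in (0 : ℝ)..t,
        M.V1right k (fun u => G s u k) (η N s.toNNReal ω)‖ₑ ∂(ℙ N)) atTop = 0) ∧
    limsup (fun ε : ℝ => limsup (fun N : ℕ => ∫⁻ ω, ‖∫ s in (0 : ℝ)..t,
        M.V2left ε k (fun u => G s u k) (η N s.toNNReal ω)‖ₑ ∂(ℙ N)) atTop) (𝓝[>] 0) = 0 ∧
    limsup (fun ε : ℝ => limsup (fun N : ℕ => ∫⁻ ω, ‖∫ s in (0 : ℝ)..t,
        M.V2right ε k (fun u => G s u k) (η N s.toNNReal ω)‖ₑ ∂(ℙ N)) atTop) (𝓝[>] 0) = 0 := by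
  have hGk : ContinuousOn (Function.uncurry fun s u => G s u k) (Set.Icc 0 t ×ˢ Set.univ) :=
    ((continuous_apply k).comp_continuousOn hG).mono
      (Set.prod_mono (Set.Icc_subset_Icc le_rfl ht.2) subset_rfl)
  have hC : 0 ≤ 3 * M.compNorm k := mul_nonneg (by norm_num) (M.compNorm_nonneg k)
  have hα : ∀ v u, M.α v u ∈ Set.Ioo (0 : ℝ) 1 := fun v u => by
    obtain ⟨A, -, hA, h⟩ := M.α_range v
    exact hA (h u)
  have hβ : ∀ v u, M.β v u ∈ Set.Ioo (0 : ℝ) 1 := fun v u => by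
    obtain ⟨A, -, hA, h⟩ := M.β_range v
    exact hA (h u)
  have hP : 0 ≤ M.poissonConst k := by
    have := M.compNorm_nonneg k
    have := M.jumpMoment_nonneg
    unfold poissonConst
    positivity
  refine ⟨fun hθ1 => ?_, ?_⟩
  · have hsmall : ∀ K δ : ℝ, 0 < δ →
        ∀ᶠ N : ℕ in atTop, 3 ≤ N ∧ K * M.poissonConst k * (N : ℝ) ^ (θ - 1) ≤ δ := by
      intro K δ hδ
      have h1 : Tendsto (fun N : ℕ => K * M.poissonConst k * (N : ℝ) ^ (θ - 1)) atTop (𝓝 0) := by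
        have := (tendsto_rpow_neg_atTop (sub_pos.2 hθ1)).comp (tendsto_natCast_atTop_atTop (R := ℝ))
        simpa using this.const_mul (K * M.poissonConst k)
      exact (eventually_ge_atTop 3).and ((h1.eventually_lt_const hδ).mono fun _ h => h.le)
    constructor
    · refine limsup_eq_zero_of_eventually_le fun κ hκ => ?_
      obtain ⟨δ, hδ, K, hK, h⟩ := exists_threshold ht.1 hℙ hη hGk hC hκ
      filter_upwards [hsmall K δ hδ] with N hN
      refine h N (leftSites n N) (fun ξ x => I k ξ x - ∑ v, comp v k * M.α v (scaled x))
        (card_leftSites (by omega)).le (fun ξ x _ => abs_I_sub_density_le k ξ x fun v => hα v _)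
        fun g hg => ?_
      obtain ⟨F, h1, h2⟩ := exists_poisson_V1left (M := M) hg k θ hN.1
      exact ⟨F, fun ξ => (h1 ξ).trans hN.2, fun ξ => (h2 ξ).trans hN.2⟩
    · refine limsup_eq_zero_of_eventually_le fun κ hκ => ?_
      obtain ⟨δ, hδ, K, hK, h⟩ := exists_threshold ht.1 hℙ hη hGk hC hκ
      filter_upwards [hsmall K δ hδ] with N hN
      refine h N (rightSites n N) (fun ξ x => I k ξ x - ∑ v, comp v k * M.β v (scaled x))
        (card_rightSites (by omega)).le (fun ξ x _ => abs_I_sub_density_le k ξ x fun v => hβ v _)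
        fun g hg => ?_
      obtain ⟨F, h1, h2⟩ := exists_poisson_V1right (M := M) hg k θ hN.1
      exact ⟨F, fun ξ => (h1 ξ).trans hN.2, fun ξ => (h2 ξ).trans hN.2⟩
  · have hε : ∀ K δ : ℝ, 0 ≤ K → 0 < δ →
        ∀ᶠ ε : ℝ in 𝓝[>] 0, 0 < ε ∧ ε ≤ 1 / 2 ∧ K * M.poissonConst k * (3 * ε) ≤ δ := by
      intro K δ hK hδ
      have h1 : Tendsto (fun ε : ℝ => K * M.poissonConst k * (3 * ε)) (𝓝[>] 0) (𝓝 0) := by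
        refine Tendsto.mono_left ?_ nhdsWithin_le_nhds
        have : Continuous fun ε : ℝ => K * M.poissonConst k * (3 * ε) := by fun_prop
        simpa using this.tendsto 0
      filter_upwards [self_mem_nhdsWithin, Ioc_mem_nhdsGT (by norm_num : (0 : ℝ) < 1 / 2),
        h1.eventually_lt_const hδ] with ε h2 h3 h4
      exact ⟨h2, h3.2, h4.le⟩
    constructor
    · refine limsup_eq_zero_of_eventually_le fun κ hκ => ?_
      obtain ⟨δ, hδ, K, hK, h⟩ := exists_threshold ht.1 hℙ hη hGk hC hκ
      filter_upwards [hε K δ hK hδ] with ε ⟨hε0, hε2, hεδ⟩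
      refine limsup_le_of_le (by isBoundedDefault) ?_
      filter_upwards [eventually_window hε0 hε2] with N ⟨hN, hm, hmN, hw⟩
      have hw' := (mul_le_mul_of_nonneg_left hw (mul_nonneg hK hP)).trans hεδ
      refine h N (leftSites n N) (fun ξ x => I k ξ x - (1 / (⌊ε * N⌋₊ : ℝ)) *
          ∑ y ∈ (Finset.univ : Finset ↥(Finset.Ico 1 N)).filter
            (fun y : ↥(Finset.Ico 1 N) => (y.1 : ℕ) ≤ ⌊ε * N⌋₊ + 1), I k ξ (y, x.2))
        (card_leftSites (by omega)).le
        (fun ξ x _ => abs_I_sub_average_le k ξ x hm (card_leftWindow hmN)) fun g hg => ?_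
      obtain ⟨F, h1, h2⟩ := exists_poisson_V2left (M := M) hg k θ ε hN hm hmN
      exact ⟨F, fun ξ => (h1 ξ).trans hw', fun ξ => (h2 ξ).trans hw'⟩
    · refine limsup_eq_zero_of_eventually_le fun κ hκ => ?_
      obtain ⟨δ, hδ, K, hK, h⟩ := exists_threshold ht.1 hℙ hη hGk hC hκ
      filter_upwards [hε K δ hK hδ] with ε ⟨hε0, hε2, hεδ⟩
      refine limsup_le_of_le (by isBoundedDefault) ?_
      filter_upwards [eventually_window hε0 hε2] with N ⟨hN, hm, hmN, hw⟩
      have hw' := (mul_le_mul_of_nonneg_left hw (mul_nonneg hK hP)).trans hεδ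
      refine h N (rightSites n N) (fun ξ x => I k ξ x - (1 / (⌊ε * N⌋₊ : ℝ)) *
          ∑ y ∈ (Finset.univ : Finset ↥(Finset.Ico 1 N)).filter
            (fun y : ↥(Finset.Ico 1 N) => N ≤ (y.1 : ℕ) + 1 + ⌊ε * N⌋₊), I k ξ (y, x.2))
        (card_rightSites (by omega)).le
        (fun ξ x _ => abs_I_sub_average_le k ξ x hm (card_rightWindow hmN)) fun g hg => ?_
      obtain ⟨F, h1, h2⟩ := exists_poisson_V2right (M := M) hg k θ ε hN hm hmN
      exact ⟨F, fun ξ => (h1 ξ).trans hw', fun ξ => (h2 ξ).trans hw'⟩
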